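/- For $n\in\mathbb N_0$ with binary digits $n_j$ (so $n=\sum_j n_j2^j$) let $w_n(x)=\prod_{j\ge0} r_j(x)^{n_j}$, $r_j(x)=(-1)^{\lfloor 2^{j+1}x\rfloor}$, be the Walsh–Paley functions on $[0,1)$. For $f\in L^1([0,1))$ put $\widehat f(k)=\int_0^1 f(x)w_k(x)\,dx$ and $S_k(f;x)=\sum_{i=0}^{k-1}\widehat f(i)w_i(x)$ (so $S_0=0$). Let $\lambda=(\lambda_n)_{n\ge1}$ be a nondecreasing sequence of integers with $1\le\lambda_n\le n$ for all $n\ge1$, and define the de la Vallée Poussin means $$V_n^{(\lambda)}(f;x)=\frac1{\lambda_n+1}\sum_{k=n-\lambda_n}^{n}S_k(f;x),\qquad n\ge1.$$ **Theorem 1.1.** (a) If $n=O(\lambda_n)$ as $n\to\infty$, then for every $f\in L^1([0,1))$, $V_n^{(\lambda)}(f;x)\to f(x)$ as $n\to\infty$ for almost every $x\in[0,1)$. (b) Let $\omega:[0,\infty)\to[0,\infty)$ be an Orlicz function, that is, $\omega$ is continuous and convex, $\omega(0)=0$, $\omega(u)>0$ for $u>0$, and $\omega(u)\to\infty$ as $u\to\infty$.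 Assume that $\omega(t)=o\bigl(t\sqrt{\log t}\bigr)$ as $t\to\infty$. If $\sup_{n\ge1} n/\lambda_n=\infty$, then there exists a function $f$ in the Orlicz class $L_\omega([0,1))=\{f\text{ measurable on }[0,1):\int_0^1\omega(|f(x)|)\,dx<\infty\}$ (which is contained in $L^1([0,1))$) such that $$\limsup_{n\to\infty}|V_n^{(\lambda)}(f;x)|=\infty\qquad\text{for every }x\in[0,1).$$ Both parts hold for real-valued and for complex-valued functions. -/

import Mathlib

open Set Filter Topology MeasureTheory Asymptotics

noncomputable section

namespace WalshVP

/-- The Rademacher function `r_j(x) = (-1)^⌊2^(j+1) x⌋`. -/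
def rademacher (j : ℕ) (x : ℝ) : ℝ :=
  (-1 : ℝ) ^ ⌊(2 : ℝ) ^ (j + 1) * x⌋

/-- The Walsh function in the Paley ordering, `w_n(x) = ∏_j r_j(x)^(n_j)`, where
`n_j = n / 2^j % 2` is the `j`-th binary digit of `n`; the digits with `j ≥ n.size` vanish. -/
def walsh (n : ℕ) (x : ℝ) : ℝ :=
  ∏ j ∈ Finset.range n.size, rademacher j x ^ (n / 2 ^ j % 2)

variable {E : Type*} [NormedAddCommGroup E] [NormedSpace ℝ E]

/-- The `n`-th Walsh coefficient of `f` on `[0,1)`. -/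
def walshCoeff (f : ℝ → E) (n : ℕ) : E :=
  ∫ x in Ico (0 : ℝ) 1, walsh n x • f x

/-- The `n`-th Walsh partial sum: the sum over the frequencies `0, …, n - 1`. -/
def partialSum (f : ℝ → E) (n : ℕ) (x : ℝ) : E :=
  ∑ k ∈ Finset.range n, walsh k x • walshCoeff f k

/-- The de la Vallée Poussin mean
`V_n(f; x) = (1 / (lam n + 1)) * ∑_{k = n - lam n}^{n} S_k(f; x)` (used for `lam n ≤ n`). -/
def vpMean (lam : ℕ → ℕ) (f : ℝ → E) (n : ℕ) (x : ℝ) : E :=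
  ((lam n : ℝ) + 1)⁻¹ • ∑ k ∈ Finset.Icc (n - lam n) n, partialSum f k x

/-- Orlicz functions on `[0, ∞)`; values at negative arguments are irrelevant. -/
structure IsOrlicz (ω : ℝ → ℝ) : Prop where
  continuousOn : ContinuousOn ω (Ici 0)
  convexOn : ConvexOn ℝ (Ici 0) ω
  map_zero : ω 0 = 0
  pos : ∀ u, 0 < u → 0 < ω u
  tendsto_atTop : Tendsto ω atTop atTop

/-- Membership in the Orlicz class `L_ω([0,1))`: `f` is (Lebesgue) measurable on `[0,1)` and
`∫_0^1 ω(|f(x)|) dx < ∞`. -/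
def MemOrliczClass (ω : ℝ → ℝ) (f : ℝ → E) : Prop :=
  AEStronglyMeasurable f (volume.restrict (Ico (0 : ℝ) 1)) ∧
    ∫⁻ x in Ico (0 : ℝ) 1, ENNReal.ofReal (ω ‖f x‖) < ⊤

end WalshVP

end

noncomputable section

namespace WalshVP

open scoped ENNReal

/-! (a) A de la Vallée Poussin mean is a difference of two Fejér sums divided by `lam n + 1`. When
`n = O(lam n)`, it is therefore controlled by the maximal Fejér operator. A.e. convergence then
follows from a weak (1,1) bound, density of Walsh polynomials and Borel–Cantelli. For the weak
bound, the Fejér kernels are dominated by dyadic kernels and by dyadic kernels with one digit `j`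
flipped, with weights `2 ^ j` (`abs_fejerKernel_le`). Where the dyadic maximal function is at most
`c`, a flipped average exceeds `c` only through points whose averages first pass `c` between ranks
`j` and `i` (`flipAvg_le`). The geometric weights make the total contribution of such points at most
twice the mass of `g` (`tsum_stopSet_le`).

(b) The core is a nonnegative Walsh polynomial of integral 1 that takes only the values 0 and `H`,
and has at every point a block of partial sum of size about `√(log H)` (`exists_walsh_polynomial`).
It is a Riesz product `∏ (1 + β_c r_{Q+e(c)})` with signs `β_c` depending on the first `Q` digits.
Each subproduct `∏_{c ∈ S} β_c` occupies its own frequency block (`walshCoeff_rieszProd`), so `S`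
may be chosen depending on `x`. The `β_c` indicate by their sign whether a window of digits follows
a given pattern. With the patterns of `x` selected, passing one more window flips the sign of the
product seen from `x`. About `q` martingale differences are then bounded below by a constant, and an
extra factor `radProd J` makes a single Walsh partial sum add them up. About `q ^ 2` factors are
enough, so `log H` is of order `q ^ 2`; this is the source of `t √(log t)`.

Dilating by `2 ^ b` creates spectral gaps of length `2 ^ b`. If `lam n < 2 ^ b`, the mean at a
multiple of `2 ^ b` averages equal partial sums and has no smoothing effect
(`vpMean_sub_vpMean_of_block`). Unboundedness of `n / lam n` and monotonicity supply such scales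
(`exists_scale`). A weighted sum of dilated polynomials on separated scales diverges everywhere, and
convexity of `ω` keeps it in the Orlicz class. -/

/-! ### Rademacher functions and their products -/

theorem rademacher_mul_self (j : ℕ) (x : ℝ) : rademacher j x * rademacher j x = 1 := by
  unfold rademacher
  rw [← mul_zpow]; norm_num

theorem rademacher_eq_or (j : ℕ) (x : ℝ) : rademacher j x = 1 ∨ rademacher j x = -1 :=
  mul_self_eq_one_iff.mp (rademacher_mul_self j x)

theorem abs_rademacher (j : ℕ) (x : ℝ) : |rademacher j x| = 1 := by
  rcases rademacher_eq_or j x with h | h <;> simp [h]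

theorem rademacher_add_half (j : ℕ) (x : ℝ) :
    rademacher j (x + (2 ^ (j + 1))⁻¹) = -rademacher j x := by
  unfold rademacher
  have h : (2 : ℝ) ^ (j + 1) * (x + (2 ^ (j + 1))⁻¹) = 2 ^ (j + 1) * x + 1 := by
    field_simp
  rw [h, Int.floor_add_one, zpow_add_one₀ (by norm_num)]
  ring

theorem rademacher_add_of_lt {i j : ℕ} (h : j < i) (x : ℝ) :
    rademacher i (x + (2 ^ (j + 1))⁻¹) = rademacher i x := by
  unfold rademacher
  obtain ⟨k, rfl⟩ := Nat.exists_eq_add_of_lt h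
  have h : (2 : ℝ) ^ (j + k + 1 + 1) * (x + (2 ^ (j + 1))⁻¹)
      = 2 ^ (j + k + 1 + 1) * x + ((2 * 2 ^ k : ℤ) : ℝ) := by
    push_cast
    field_simp
    ring
  rw [h, Int.floor_add_intCast, zpow_add₀ (by norm_num), zpow_mul]
  simp

theorem rademacher_add_one (j : ℕ) (x : ℝ) : rademacher j (x + 1) = rademacher j x := by
  unfold rademacher
  have h : (2 : ℝ) ^ (j + 1) * (x + 1) = 2 ^ (j + 1) * x + ((2 * 2 ^ j : ℤ) : ℝ) := by
    push_cast
    ring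
  rw [h, Int.floor_add_intCast, zpow_add₀ (by norm_num), zpow_mul]
  simp

theorem rademacher_two_pow_mul (a j : ℕ) (x : ℝ) :
    rademacher j (2 ^ a * x) = rademacher (a + j) x := by
  unfold rademacher
  congr 2
  ring

@[fun_prop]
theorem measurable_rademacher (j : ℕ) : Measurable (rademacher j) := by
  unfold rademacher
  have : Measurable (fun z : ℤ => (-1 : ℝ) ^ z) := measurable_from_top
  exact this.comp (Int.measurable_floor.comp (measurable_id.const_mul _))

/-- The product of the Rademacher functions with index in `S`. -/
def radProd (S : Finset ℕ) (x : ℝ) : ℝ := ∏ j ∈ S, rademacher j x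

@[fun_prop]
theorem measurable_radProd (S : Finset ℕ) : Measurable (radProd S) := by
  unfold radProd
  fun_prop

theorem radProd_mul_self (S : Finset ℕ) (x : ℝ) : radProd S x * radProd S x = 1 := by
  rw [radProd, ← Finset.prod_mul_distrib]
  simp [rademacher_mul_self]

theorem abs_radProd (S : Finset ℕ) (x : ℝ) : |radProd S x| = 1 := by
  rw [radProd, Finset.abs_prod]
  simp [abs_rademacher]

theorem radProd_mul (S T : Finset ℕ) (x : ℝ) :
    radProd S x * radProd T x = radProd (symmDiff S T) x := by
  have h1 : radProd S x = radProd (S \ T) x * radProd (S ∩ T) x := by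
    rw [radProd, radProd, radProd, mul_comm, Finset.prod_inter_mul_prod_sdiff]
  have h2 : radProd T x = radProd (T \ S) x * radProd (S ∩ T) x := by
    rw [radProd, radProd, radProd, mul_comm, Finset.inter_comm, Finset.prod_inter_mul_prod_sdiff]
  have h3 : radProd (symmDiff S T) x = radProd (S \ T) x * radProd (T \ S) x := by
    rw [radProd, radProd, radProd, ← Finset.prod_union]
    · rfl
    · exact disjoint_sdiff_sdiff
  rw [h1, h2, h3]
  linear_combination (radProd (S \ T) x * radProd (T \ S) x) * radProd_mul_self (S ∩ T) x

/-- Translation by half a period of the factor of lowest index `j` changes the sign of that factor.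
It is a period of all the others, so the integral over the unit period equals its own negative. -/
theorem integral_radProd {S : Finset ℕ} (hS : S.Nonempty) :
    ∫ x in Ico (0 : ℝ) 1, radProd S x = 0 := by
  set j := S.min' hS
  have hj : j ∈ S := S.min'_mem hS
  have hper : Function.Periodic (radProd S) 1 := fun x => by
    simp [radProd, rademacher_add_one]
  have hneg (x : ℝ) : radProd S (x + (2 ^ (j + 1))⁻¹) = -radProd S x := by
    rw [radProd, radProd, ← Finset.mul_prod_erase _ _ hj, ← Finset.mul_prod_erase _ _ hj,
      rademacher_add_half, neg_mul]
    congr 2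
    refine Finset.prod_congr rfl fun i hi => rademacher_add_of_lt ?_ x
    exact S.min'_lt_of_mem_erase_min' hS hi
  rw [integral_Ico_eq_integral_Ioc, ← intervalIntegral.integral_of_le zero_le_one]
  have h1 := hper.intervalIntegral_add_eq 0 ((2 : ℝ) ^ (j + 1))⁻¹
  have h2 : ∫ x in (0 : ℝ)..1, radProd S (x + (2 ^ (j + 1))⁻¹)
      = ∫ x in (0 : ℝ)..1, radProd S x := by
    rw [intervalIntegral.integral_comp_add_right]
    simpa [add_comm] using h1.symm
  simp only [hneg, intervalIntegral.integral_neg] at h2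
  linarith

theorem integrableOn_of_bounded {f : ℝ → ℝ} (hf : Measurable f) {C : ℝ} (hC : ∀ x, |f x| ≤ C) :
    IntegrableOn f (Ico (0 : ℝ) 1) :=
  Measure.integrableOn_of_bounded (by simp) hf.aestronglyMeasurable (M := C)
    (Eventually.of_forall hC)

theorem integrableOn_radProd (S : Finset ℕ) : IntegrableOn (radProd S) (Ico (0 : ℝ) 1) :=
  integrableOn_of_bounded (measurable_radProd S) fun x => (abs_radProd S x).le

/-- Only the empty product survives in the expansion. Each kernel below is written in this form, so
its mass is computed without describing dyadic intervals. -/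
theorem integral_riesz (U : Finset ℕ) (c : ℕ → ℝ) :
    ∫ x in Ico (0 : ℝ) 1, ∏ l ∈ U, (1 + c l * rademacher l x) = 1 := by
  have h (x : ℝ) : ∏ l ∈ U, (1 + c l * rademacher l x)
      = ∑ S ∈ U.powerset, (∏ l ∈ S, c l) * radProd S x := by
    rw [Finset.prod_one_add]
    simp [radProd, Finset.prod_mul_distrib]
  simp only [h]
  rw [integral_finsetSum _ fun S _ => (integrableOn_radProd S).const_mul _,
    Finset.sum_eq_single ∅]
  · simp [radProd]
  · intro S _ hS
    rw [integral_const_mul, integral_radProd (Finset.nonempty_iff_ne_empty.mpr hS), mul_zero]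
  · simp

/-! ### Walsh functions -/

theorem walsh_eq_prod_of_lt {n B : ℕ} (h : n < 2 ^ B) (x : ℝ) :
    walsh n x = ∏ j ∈ Finset.range B, rademacher j x ^ (n / 2 ^ j % 2) := by
  rw [walsh]
  refine Finset.prod_subset (Finset.range_mono (Nat.size_le.mpr h)) fun j _ hj => ?_
  have : n < 2 ^ j := Nat.size_le.mp (by simpa using hj)
  simp [Nat.div_eq_of_lt this]

theorem walsh_zero (x : ℝ) : walsh 0 x = 1 := by simp [walsh]

theorem walsh_add {Q i : ℕ} (h : ℕ) (hi : i < 2 ^ Q) (x : ℝ) :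
    walsh (2 ^ Q * h + i) x = walsh h (2 ^ Q * x) * walsh i x := by
  obtain ⟨B, hB⟩ : ∃ B, h < 2 ^ B := ⟨h, Nat.lt_two_pow_self⟩
  have hlt : 2 ^ Q * h + i < 2 ^ (Q + B) := by
    rw [pow_add]
    calc 2 ^ Q * h + i < 2 ^ Q * (h + 1) := by rw [mul_add_one]; omega
      _ ≤ _ := Nat.mul_le_mul_left _ hB
  rw [walsh_eq_prod_of_lt hlt, walsh_eq_prod_of_lt hB, walsh_eq_prod_of_lt hi,
    Finset.prod_range_add, mul_comm]
  congr 1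
  · refine Finset.prod_congr rfl fun j _ => ?_
    rw [rademacher_two_pow_mul]
    congr 2
    rw [pow_add, ← Nat.div_div_eq_div_mul, Nat.mul_add_div (by positivity),
      Nat.div_eq_of_lt hi, add_zero]
  · refine Finset.prod_congr rfl fun j hj => ?_
    congr 1
    have hj : j < Q := Finset.mem_range.mp hj
    obtain ⟨k, rfl⟩ := Nat.exists_eq_add_of_lt hj
    have : 2 ^ (j + k + 1) * h + i = 2 ^ j * (2 * (2 ^ k * h)) + i := by ring
    rw [this, Nat.mul_add_div (by positivity)]
    omega

theorem walsh_one (x : ℝ) : walsh 1 x = rademacher 0 x := by simp [walsh]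

theorem walsh_two_pow_add {A m : ℕ} (hm : m < 2 ^ A) (x : ℝ) :
    walsh (2 ^ A + m) x = rademacher A x * walsh m x := by
  have := walsh_add 1 hm x
  rwa [mul_one, walsh_one, rademacher_two_pow_mul] at this

theorem walsh_two_pow_mul (a n : ℕ) (x : ℝ) : walsh (2 ^ a * n) x = walsh n (2 ^ a * x) := by
  simpa [walsh_zero] using walsh_add (Q := a) (i := 0) n (by positivity) x

/-- The number whose binary digits equal to one are those with index in `S`. -/
def ofBits (S : Finset ℕ) : ℕ := ∑ j ∈ S, 2 ^ j

theorem ofBits_lt {S : Finset ℕ} {A : ℕ} (h : ∀ j ∈ S, j < A) : ofBits S < 2 ^ A :=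
  Nat.geomSum_lt le_rfl h

theorem ofBits_insert {S : Finset ℕ} {A : ℕ} (h : ∀ j ∈ S, j < A) :
    ofBits (insert A S) = 2 ^ A + ofBits S :=
  Finset.sum_insert fun hA => (h A hA).false

theorem walsh_ofBits (S : Finset ℕ) (x : ℝ) : walsh (ofBits S) x = radProd S x := by
  induction S using Finset.induction_on_max with
  | empty => simp [ofBits, radProd, walsh_zero]
  | insert A S h ih =>
    rw [ofBits_insert h, walsh_two_pow_add (ofBits_lt h), ih, radProd, radProd,
      Finset.prod_insert fun hA => (h A hA).false]

theorem exists_ofBits (n : ℕ) : ∃ S : Finset ℕ, ofBits S = n :=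
  ⟨n.bitIndices.toFinset, Finset.sum_toFinset_bitIndices_two_pow n⟩

@[fun_prop]
theorem measurable_walsh (n : ℕ) : Measurable (walsh n) := by
  unfold walsh
  fun_prop

theorem abs_walsh (n : ℕ) (x : ℝ) : |walsh n x| = 1 := by
  obtain ⟨S, rfl⟩ := exists_ofBits n
  rw [walsh_ofBits, abs_radProd]

theorem walsh_mul_self (n : ℕ) (x : ℝ) : walsh n x * walsh n x = 1 := by
  obtain ⟨S, rfl⟩ := exists_ofBits n
  rw [walsh_ofBits, radProd_mul_self]

theorem integral_walsh_mul_walsh (m n : ℕ) :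
    ∫ x in Ico (0 : ℝ) 1, walsh m x * walsh n x = if m = n then 1 else 0 := by
  split_ifs with h
  · subst h
    simp [walsh_mul_self]
  · obtain ⟨S, rfl⟩ := exists_ofBits m
    obtain ⟨T, rfl⟩ := exists_ofBits n
    simp only [walsh_ofBits, radProd_mul]
    refine integral_radProd (Finset.nonempty_iff_ne_empty.mpr fun h0 => h ?_)
    have : S = T := by simpa using h0
    rw [this]

/-! ### Dirichlet kernels -/

/-- The kernel `∑_{i < n} w_i(x) w_i(t)`. -/
def dirichletKernel (n : ℕ) (x t : ℝ) : ℝ := ∑ i ∈ Finset.range n, walsh i x * walsh i t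

/-- The kernel `2 ^ m` on pairs whose first `m` binary digits agree, `0` elsewhere. -/
def dyadicKernel (m : ℕ) (x t : ℝ) : ℝ :=
  ∏ l ∈ Finset.range m, (1 + rademacher l x * rademacher l t)

theorem dirichletKernel_two_pow_add {A m : ℕ} (hm : m ≤ 2 ^ A) (x t : ℝ) :
    dirichletKernel (2 ^ A + m) x t
      = dirichletKernel (2 ^ A) x t + rademacher A x * rademacher A t * dirichletKernel m x t := by
  rw [dirichletKernel, Finset.sum_range_add, ← dirichletKernel]
  congr 1
  rw [dirichletKernel, Finset.mul_sum]
  refine Finset.sum_congr rfl fun i hi => ?_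
  have hi : i < 2 ^ A := (Finset.mem_range.mp hi).trans_le hm
  rw [walsh_two_pow_add hi, walsh_two_pow_add hi]
  ring

theorem dirichletKernel_two_pow (A : ℕ) (x t : ℝ) :
    dirichletKernel (2 ^ A) x t = dyadicKernel A x t := by
  induction A with
  | zero => simp [dirichletKernel, dyadicKernel, walsh_zero]
  | succ A ih =>
    rw [pow_succ, mul_two, dirichletKernel_two_pow_add le_rfl, ih, dyadicKernel, dyadicKernel,
      Finset.prod_range_succ]
    ring

/-- The first `m` binary digits of (the fractional parts of) `x` and `t` agree. -/
def AgreeTo (m : ℕ) (x t : ℝ) : Prop := ∀ l < m, rademacher l x = rademacher l t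

theorem AgreeTo.symm {m : ℕ} {x t : ℝ} (h : AgreeTo m x t) : AgreeTo m t x :=
  fun l hl => (h l hl).symm

theorem AgreeTo.mono {m n : ℕ} {x t : ℝ} (h : AgreeTo n x t) (hmn : m ≤ n) : AgreeTo m x t :=
  fun l hl => h l (hl.trans_le hmn)

theorem one_add_rademacher_mul_nonneg (l : ℕ) (x t : ℝ) :
    0 ≤ 1 + rademacher l x * rademacher l t := by
  rcases rademacher_eq_or l x with h | h <;> rcases rademacher_eq_or l t with h' | h' <;>
    norm_num [h, h']

theorem one_sub_rademacher_mul_nonneg (l : ℕ) (x t : ℝ) :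
    0 ≤ 1 - rademacher l x * rademacher l t := by
  rcases rademacher_eq_or l x with h | h <;> rcases rademacher_eq_or l t with h' | h' <;>
    norm_num [h, h']

theorem one_add_rademacher_mul_ne_zero_iff (l : ℕ) (x t : ℝ) :
    1 + rademacher l x * rademacher l t ≠ 0 ↔ rademacher l x = rademacher l t := by
  rcases rademacher_eq_or l x with h | h <;> rcases rademacher_eq_or l t with h' | h' <;>
    norm_num [h, h']

theorem one_sub_rademacher_mul_ne_zero_iff (l : ℕ) (x t : ℝ) :
    1 - rademacher l x * rademacher l t ≠ 0 ↔ rademacher l t = -rademacher l x := by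
  rcases rademacher_eq_or l x with h | h <;> rcases rademacher_eq_or l t with h' | h' <;>
    norm_num [h, h']

theorem dyadicKernel_ne_zero_iff (m : ℕ) (x t : ℝ) :
    dyadicKernel m x t ≠ 0 ↔ AgreeTo m x t := by
  simp only [dyadicKernel, Finset.prod_ne_zero_iff, one_add_rademacher_mul_ne_zero_iff,
    Finset.mem_range, AgreeTo]

theorem dyadicKernel_nonneg (m : ℕ) (x t : ℝ) : 0 ≤ dyadicKernel m x t :=
  Finset.prod_nonneg fun l _ => one_add_rademacher_mul_nonneg l x t

theorem dyadicKernel_comm (m : ℕ) (x t : ℝ) : dyadicKernel m x t = dyadicKernel m t x := by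
  simp only [dyadicKernel, mul_comm]

theorem dyadicKernel_congr {m : ℕ} {x y : ℝ} (h : AgreeTo m x y) (t : ℝ) :
    dyadicKernel m x t = dyadicKernel m y t :=
  Finset.prod_congr rfl fun l hl => by rw [h l (Finset.mem_range.mp hl)]

theorem integral_dyadicKernel (m : ℕ) (x : ℝ) :
    ∫ t in Ico (0 : ℝ) 1, dyadicKernel m x t = 1 :=
  integral_riesz _ _

@[fun_prop]
theorem measurable_dyadicKernel (m : ℕ) :
    Measurable fun z : ℝ × ℝ => dyadicKernel m z.1 z.2 := by
  unfold dyadicKernel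
  fun_prop

theorem walsh_congr {n B : ℕ} (hn : n < 2 ^ B) {x y : ℝ} (h : AgreeTo B x y) :
    walsh n x = walsh n y := by
  rw [walsh_eq_prod_of_lt hn, walsh_eq_prod_of_lt hn]
  exact Finset.prod_congr rfl fun l hl => by rw [h l (Finset.mem_range.mp hl)]

theorem integral_dyadicKernel_mul {m : ℕ} {g : ℝ → ℝ} (hg : ∀ x y, AgreeTo m x y → g x = g y)
    (x : ℝ) : ∫ t in Ico (0 : ℝ) 1, dyadicKernel m x t * g t = g x := by
  have h (t : ℝ) : dyadicKernel m x t * g t = dyadicKernel m x t * g x := by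
    by_cases h0 : dyadicKernel m x t = 0
    · simp [h0]
    · rw [hg x t ((dyadicKernel_ne_zero_iff m x t).mp h0)]
  simp only [h]
  rw [integral_mul_const, integral_dyadicKernel, one_mul]

/-! ### Fejér kernels -/

/-- The sum of the first `n` Dirichlet kernels. -/
def fejerKernel (n : ℕ) (x t : ℝ) : ℝ := ∑ k ∈ Finset.range n, dirichletKernel k x t

/-- The dyadic kernel of `x` with the digit number `j` flipped (for `j < A`). -/
def flipKernel (A j : ℕ) (x t : ℝ) : ℝ :=
  (1 - rademacher j x * rademacher j t) *
    ∏ l ∈ (Finset.range A).erase j, (1 + rademacher l x * rademacher l t)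

theorem flipKernel_nonneg (A j : ℕ) (x t : ℝ) : 0 ≤ flipKernel A j x t :=
  mul_nonneg (one_sub_rademacher_mul_nonneg j x t)
    (Finset.prod_nonneg fun l _ => one_add_rademacher_mul_nonneg l x t)

theorem flipKernel_comm (A j : ℕ) (x t : ℝ) : flipKernel A j x t = flipKernel A j t x := by
  simp only [flipKernel, mul_comm (rademacher _ x)]

@[fun_prop]
theorem measurable_flipKernel (A j : ℕ) :
    Measurable fun z : ℝ × ℝ => flipKernel A j z.1 z.2 := by
  unfold flipKernel
  fun_prop

theorem flipKernel_ne_zero {A j : ℕ} {x t : ℝ} (h : flipKernel A j x t ≠ 0) :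
    rademacher j t = -rademacher j x ∧ ∀ l < A, l ≠ j → rademacher l x = rademacher l t := by
  rw [flipKernel, mul_ne_zero_iff, one_sub_rademacher_mul_ne_zero_iff,
    Finset.prod_ne_zero_iff] at h
  exact ⟨h.1, fun l hl hlj => (one_add_rademacher_mul_ne_zero_iff l x t).mp
    (h.2 l (by simp [hl, hlj]))⟩

theorem flipKernel_eq_dyadicKernel {A j : ℕ} (hj : j < A) {x s : ℝ}
    (h : flipKernel A j x s ≠ 0) (t : ℝ) : flipKernel A j x t = dyadicKernel A s t := by
  obtain ⟨h1, h2⟩ := flipKernel_ne_zero h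
  rw [dyadicKernel, ← Finset.mul_prod_erase _ _ (Finset.mem_range.mpr hj), flipKernel, h1]
  congr 1
  · ring
  · refine Finset.prod_congr rfl fun l hl => ?_
    rw [h2 l (by simpa using (Finset.mem_erase.mp hl).2) (Finset.mem_erase.mp hl).1]

theorem integral_flipKernel {A j : ℕ} (hj : j < A) (x : ℝ) :
    ∫ t in Ico (0 : ℝ) 1, flipKernel A j x t = 1 := by
  refine Eq.trans (integral_congr_ae (Eventually.of_forall fun t => ?_))
    (integral_riesz (Finset.range A)
      (fun l => if l = j then -rademacher l x else rademacher l x))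
  rw [← Finset.mul_prod_erase _ _ (Finset.mem_range.mpr hj), flipKernel]
  congr 1
  · simp [sub_eq_add_neg]
  · refine Finset.prod_congr rfl fun l hl => ?_
    rw [if_neg (Finset.mem_erase.mp hl).1]

theorem fejerKernel_two_pow_add {A m : ℕ} (hm : m ≤ 2 ^ A) (x t : ℝ) :
    fejerKernel (2 ^ A + m) x t = fejerKernel (2 ^ A) x t + m * dyadicKernel A x t
      + rademacher A x * rademacher A t * fejerKernel m x t := by
  rw [fejerKernel, Finset.sum_range_add, ← fejerKernel, add_assoc]
  congr 1
  rw [fejerKernel, Finset.mul_sum,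
    Finset.sum_congr rfl fun k hk => dirichletKernel_two_pow_add
      ((Finset.mem_range.mp hk).le.trans hm) x t, Finset.sum_add_distrib, dirichletKernel_two_pow]
  simp

/-- Passing from `A` to `A + 1` multiplies the old dyadic and flipped kernels by `1 + r_A(x)
r_A(t)`, and adds `2 * 2 ^ A * dyadicKernel A`. The latter is the new term `j = A`, because the
dyadic kernel of rank `A + 1` and its flip at `A` sum to twice the kernel of rank `A`. -/
theorem two_mul_fejerKernel_two_pow (A : ℕ) (x t : ℝ) :
    2 * fejerKernel (2 ^ A) x t
      = ∑ j ∈ Finset.range A, 2 ^ j * (dyadicKernel A x t + flipKernel A j x t) := by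
  induction A with
  | zero => simp [fejerKernel, dirichletKernel]
  | succ A ih =>
    have hD : dyadicKernel (A + 1) x t
        = dyadicKernel A x t * (1 + rademacher A x * rademacher A t) := by
      rw [dyadicKernel, Finset.prod_range_succ, dyadicKernel]
    have hA : flipKernel (A + 1) A x t
        = dyadicKernel A x t * (1 - rademacher A x * rademacher A t) := by
      rw [flipKernel, Finset.range_add_one, Finset.erase_insert (by simp), dyadicKernel, mul_comm]
    have hF (j : ℕ) (hj : j ∈ Finset.range A) : flipKernel (A + 1) j x t
        = flipKernel A j x t * (1 + rademacher A x * rademacher A t) := by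
      have hne : A ≠ j := (Finset.mem_range.mp hj).ne'
      rw [flipKernel, Finset.range_add_one, Finset.erase_insert_of_ne hne,
        Finset.prod_insert (by simp), flipKernel]
      ring
    rw [Finset.sum_range_succ, Finset.sum_congr rfl fun j hj => by rw [hF j hj], hA, hD,
      pow_succ, mul_two, fejerKernel_two_pow_add le_rfl]
    have : ∑ j ∈ Finset.range A, 2 ^ j *
        (dyadicKernel A x t * (1 + rademacher A x * rademacher A t)
          + flipKernel A j x t * (1 + rademacher A x * rademacher A t))
        = (1 + rademacher A x * rademacher A t) * (2 * fejerKernel (2 ^ A) x t) := by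
      rw [ih, Finset.mul_sum]
      exact Finset.sum_congr rfl fun j _ => by ring
    rw [this]
    push_cast
    ring

theorem fejerKernel_two_pow_nonneg (A : ℕ) (x t : ℝ) : 0 ≤ fejerKernel (2 ^ A) x t := by
  have h := two_mul_fejerKernel_two_pow A x t
  have : 0 ≤ ∑ j ∈ Finset.range A, 2 ^ j * (dyadicKernel A x t + flipKernel A j x t) :=
    Finset.sum_nonneg fun j _ => mul_nonneg (by positivity)
      (add_nonneg (dyadicKernel_nonneg _ _ _) (flipKernel_nonneg _ _ _ _))
  linarith

/-- A nonnegative majorant of the kernels `fejerKernel n`, `n < 2 ^ B`. -/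
def fejerMajorant (B : ℕ) (x t : ℝ) : ℝ :=
  ∑ A ∈ Finset.range B, (2 * 2 ^ A * dyadicKernel A x t
    + ∑ j ∈ Finset.range A, 2 ^ j * flipKernel A j x t)

theorem fejerKernel_two_pow_le (A : ℕ) (x t : ℝ) :
    fejerKernel (2 ^ A) x t ≤ 2 ^ A * dyadicKernel A x t
      + ∑ j ∈ Finset.range A, 2 ^ j * flipKernel A j x t := by
  have h := two_mul_fejerKernel_two_pow A x t
  simp only [mul_add, Finset.sum_add_distrib, ← Finset.sum_mul] at h
  have h0 : 0 ≤ ∑ j ∈ Finset.range A, 2 ^ j * flipKernel A j x t :=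
    Finset.sum_nonneg fun j _ => mul_nonneg (by positivity) (flipKernel_nonneg _ _ _ _)
  have h1 : ∑ j ∈ Finset.range A, (2 : ℝ) ^ j = 2 ^ A - 1 := by
    rw [geom_sum_eq (by norm_num)]; norm_num
  have h2 := dyadicKernel_nonneg A x t
  have h3 := fejerKernel_two_pow_nonneg A x t
  have h4 : 0 ≤ (2 : ℝ) ^ A * dyadicKernel A x t := by positivity
  rw [h1] at h
  nlinarith

/-- Strip the leading binary digit `2 ^ B` of `n`. The cross term `m * dyadicKernel B` with `m < 2 ^
B` accounts for the factor 2 in the majorant. -/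
theorem abs_fejerKernel_le {n B : ℕ} (hn : n < 2 ^ B) (x t : ℝ) :
    |fejerKernel n x t| ≤ fejerMajorant B x t := by
  induction B generalizing n with
  | zero =>
    obtain rfl : n = 0 := by simpa using hn
    simp [fejerKernel, fejerMajorant]
  | succ B ih =>
    have hB := fejerKernel_two_pow_le B x t
    have hB0 := fejerKernel_two_pow_nonneg B x t
    have hD := dyadicKernel_nonneg B x t
    have hD' : 0 ≤ (2 : ℝ) ^ B * dyadicKernel B x t := by positivity
    rw [fejerMajorant, Finset.sum_range_succ, ← fejerMajorant]
    rcases lt_or_ge n (2 ^ B) with h | h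
    · have := ih h
      linarith
    · obtain ⟨m, rfl⟩ := Nat.exists_eq_add_of_le h
      have hm : m < 2 ^ B := by rw [pow_succ] at hn; omega
      have h1 := ih hm
      rw [fejerKernel_two_pow_add hm.le]
      have h2 : |rademacher B x * rademacher B t * fejerKernel m x t| = |fejerKernel m x t| := by
        simp [abs_mul, abs_rademacher]
      have h3 : |(m : ℝ) * dyadicKernel B x t| ≤ 2 ^ B * dyadicKernel B x t := by
        rw [abs_of_nonneg (by positivity)]
        gcongr
        exact_mod_cast hm.le
      have h4 := abs_add_le (fejerKernel (2 ^ B) x t + m * dyadicKernel B x t)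
        (rademacher B x * rademacher B t * fejerKernel m x t)
      have h5 := abs_add_le (fejerKernel (2 ^ B) x t) (m * dyadicKernel B x t)
      rw [abs_of_nonneg hB0] at h5
      linarith

/-! ### The weak type estimate -/

/-- The average of `g` over the dyadic interval of rank `m` that contains `x`. -/
def dyadicAvg (m : ℕ) (g : ℝ → ℝ≥0∞) (x : ℝ) : ℝ≥0∞ :=
  ∫⁻ t in Ico (0 : ℝ) 1, ENNReal.ofReal (dyadicKernel m x t) * g t

/-- The average of `g` over the dyadic interval of rank `A` that contains `x` with the digit
number `j` flipped. -/
def flipAvg (A j : ℕ) (g : ℝ → ℝ≥0∞) (x : ℝ) : ℝ≥0∞ :=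
  ∫⁻ t in Ico (0 : ℝ) 1, ENNReal.ofReal (flipKernel A j x t) * g t

theorem dyadicAvg_congr {m : ℕ} {x y : ℝ} (h : AgreeTo m x y) (g : ℝ → ℝ≥0∞) :
    dyadicAvg m g x = dyadicAvg m g y := by
  simp only [dyadicAvg, dyadicKernel_congr h]

theorem measurable_dyadicAvg (m : ℕ) {g : ℝ → ℝ≥0∞} (hg : Measurable g) :
    Measurable (dyadicAvg m g) := by
  unfold dyadicAvg
  exact Measurable.lintegral_prod_right'
    (f := fun z : ℝ × ℝ => ENNReal.ofReal (dyadicKernel m z.1 z.2) * g z.2) (by fun_prop)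

theorem measurable_flipAvg (A j : ℕ) {g : ℝ → ℝ≥0∞} (hg : Measurable g) :
    Measurable (flipAvg A j g) := by
  unfold flipAvg
  exact Measurable.lintegral_prod_right'
    (f := fun z : ℝ × ℝ => ENNReal.ofReal (flipKernel A j z.1 z.2) * g z.2) (by fun_prop)

theorem lintegral_ofReal_eq_one {K : ℝ → ℝ} (h0 : ∀ t, 0 ≤ K t)
    (h1 : ∫ t in Ico (0 : ℝ) 1, K t = 1) :
    ∫⁻ t in Ico (0 : ℝ) 1, ENNReal.ofReal (K t) = 1 := by
  rw [← ofReal_integral_eq_lintegral_ofReal _ (Eventually.of_forall h0), h1, ENNReal.ofReal_one]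
  exact Integrable.of_integral_ne_zero (by rw [h1]; exact one_ne_zero)

theorem lintegral_dyadicKernel (m : ℕ) (x : ℝ) :
    ∫⁻ t in Ico (0 : ℝ) 1, ENNReal.ofReal (dyadicKernel m x t) = 1 :=
  lintegral_ofReal_eq_one (dyadicKernel_nonneg m x) (integral_dyadicKernel m x)

theorem lintegral_flipKernel {A j : ℕ} (hj : j < A) (x : ℝ) :
    ∫⁻ t in Ico (0 : ℝ) 1, ENNReal.ofReal (flipKernel A j x t) = 1 :=
  lintegral_ofReal_eq_one (flipKernel_nonneg A j x) (integral_flipKernel hj x)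

theorem lintegral_flipAvg {A j : ℕ} (hj : j < A) {g : ℝ → ℝ≥0∞} (hg : Measurable g) :
    ∫⁻ x in Ico (0 : ℝ) 1, flipAvg A j g x = ∫⁻ t in Ico (0 : ℝ) 1, g t := by
  unfold flipAvg
  rw [lintegral_lintegral_swap (by fun_prop)]
  refine lintegral_congr fun t => ?_
  have hm : Measurable fun x => ENNReal.ofReal (flipKernel A j x t) :=
    (((measurable_flipKernel A j).comp measurable_prodMk_right)).ennreal_ofReal
  rw [lintegral_mul_const _ hm]
  simp only [flipKernel_comm A j _ t]
  rw [lintegral_flipKernel hj, one_mul]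

/-- This is the defining property of conditional expectation: `s` is a union of dyadic intervals of
rank `m`, and the kernel is symmetric of mass 1. -/
theorem setLIntegral_dyadicAvg {m : ℕ} {g : ℝ → ℝ≥0∞} (hg : Measurable g) {s : Set ℝ}
    (hs : MeasurableSet s) (hsm : ∀ x y, AgreeTo m x y → (x ∈ s ↔ y ∈ s)) :
    ∫⁻ x in s, dyadicAvg m g x ∂(volume.restrict (Ico (0 : ℝ) 1))
      = ∫⁻ x in s, g x ∂(volume.restrict (Ico (0 : ℝ) 1)) := by
  rw [← lintegral_indicator hs, ← lintegral_indicator hs]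
  have h1 (x : ℝ) : s.indicator (dyadicAvg m g) x
      = ∫⁻ t in Ico (0 : ℝ) 1, ENNReal.ofReal (dyadicKernel m x t) * s.indicator g t := by
    by_cases hx : x ∈ s
    · rw [indicator_of_mem hx, dyadicAvg]
      refine lintegral_congr fun t => ?_
      by_cases h0 : dyadicKernel m x t = 0
      · simp [h0]
      · rw [indicator_of_mem ((hsm x t ((dyadicKernel_ne_zero_iff m x t).mp h0)).mp hx)]
    · rw [indicator_of_notMem hx, ← lintegral_zero (μ := volume.restrict (Ico (0 : ℝ) 1))]
      refine lintegral_congr fun t => ?_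
      by_cases h0 : dyadicKernel m x t = 0
      · simp [h0]
      · have := mt (hsm x t ((dyadicKernel_ne_zero_iff m x t).mp h0)).mpr hx
        simp [this]
  simp only [h1]
  have hgs : Measurable (s.indicator g) := hg.indicator hs
  rw [lintegral_lintegral_swap (by fun_prop)]
  refine lintegral_congr fun t => ?_
  have hm : Measurable fun x => ENNReal.ofReal (dyadicKernel m x t) :=
    (((measurable_dyadicKernel m).comp measurable_prodMk_right)).ennreal_ofReal
  rw [lintegral_mul_const _ hm]
  simp only [dyadicKernel_comm m _ t]
  rw [lintegral_dyadicKernel, one_mul]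

/-- Doob's maximal inequality. The disjointed sets collect the points whose first average above `c`
has rank `m`, a condition on the first `m` digits only. -/
theorem mul_measure_dyadicMaximal_le {g : ℝ → ℝ≥0∞} (hg : Measurable g) (c : ℝ≥0∞) :
    c * volume.restrict (Ico (0 : ℝ) 1) {x | ∃ m, c < dyadicAvg m g x}
      ≤ ∫⁻ x in Ico (0 : ℝ) 1, g x := by
  set μ := volume.restrict (Ico (0 : ℝ) 1)
  set s : ℕ → Set ℝ := fun m => {x | c < dyadicAvg m g x}
  have hs (m : ℕ) : MeasurableSet (s m) :=
    measurableSet_lt measurable_const (measurable_dyadicAvg m hg)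
  have hd (m : ℕ) : MeasurableSet (disjointed s m) := .disjointed hs m
  have hU : {x | ∃ m, c < dyadicAvg m g x} = ⋃ m, disjointed s m := by
    rw [iUnion_disjointed]
    ext x
    simp [s]
  rw [hU, measure_iUnion (disjoint_disjointed s) hd, ← ENNReal.tsum_mul_left]
  calc ∑' m, c * μ (disjointed s m)
      ≤ ∑' m, ∫⁻ x in disjointed s m, g x ∂μ := by
        refine ENNReal.tsum_le_tsum fun m => ?_
        rw [← setLIntegral_dyadicAvg (m := m) hg (hd m), ← setLIntegral_const]
        · exact setLIntegral_mono (measurable_dyadicAvg m hg)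
            fun x hx => (disjointed_subset s m hx : c < _).le
        · intro x y hxy
          simp only [disjointed_eq_inter_compl, mem_inter_iff, mem_iInter, mem_compl_iff, s,
            mem_ofPred_eq, dyadicAvg_congr hxy]
          refine and_congr_right fun _ => forall₂_congr fun i hi => ?_
          rw [dyadicAvg_congr (hxy.mono hi.le)]
    _ = ∫⁻ x in ⋃ m, disjointed s m, g x ∂μ :=
        (lintegral_iUnion hd (disjoint_disjointed s) g).symm
    _ ≤ _ := setLIntegral_le_lintegral _ _

/-- The points where the first average of `g` exceeding `c` has rank in `(j, i]`. -/
def stopSet (g : ℝ → ℝ≥0∞) (c : ℝ≥0∞) (j i : ℕ) : Set ℝ :=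
  {t | (∀ m ≤ j, dyadicAvg m g t ≤ c) ∧ ∃ m ≤ i, c < dyadicAvg m g t}

theorem measurableSet_stopSet {g : ℝ → ℝ≥0∞} (hg : Measurable g) (c : ℝ≥0∞) (j i : ℕ) :
    MeasurableSet (stopSet g c j i) := by
  have h (m : ℕ) := measurable_dyadicAvg m hg
  have : stopSet g c j i = (⋂ m, ⋂ (_ : m ≤ j), {t | dyadicAvg m g t ≤ c}) ∩
      ⋃ m, ⋃ (_ : m ≤ i), {t | c < dyadicAvg m g t} := by
    ext t
    simp [stopSet]
  rw [this]
  exact (MeasurableSet.iInter fun m => .iInter fun _ => measurableSet_le (h m) measurable_const).inter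
    (MeasurableSet.iUnion fun m => .iUnion fun _ => measurableSet_lt measurable_const (h m))

/-- If `τ` is the first rank at which the average at `t` exceeds `c`, then `t` contributes only for
`j < τ ≤ i`. Summing `2 ^ (j - i)` over `j < τ` gives at most `2 ^ (τ - i)`, and summing over `i ≥
τ` gives 2. -/
theorem tsum_stopSet_le (g : ℝ → ℝ≥0∞) (c : ℝ≥0∞) (t : ℝ) :
    ∑' i, ∑ j ∈ Finset.range i, (2 : ℝ≥0∞) ^ j * (2 ^ i)⁻¹ *
      (stopSet g c j i).indicator (fun _ => 1) t ≤ 2 := by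
  classical
  by_cases hex : ∃ m, c < dyadicAvg m g t
  · set τ := Nat.find hex
    have hτ : c < dyadicAvg τ g t := Nat.find_spec hex
    have hmem {j i : ℕ} (h : t ∈ stopSet g c j i) : j < τ ∧ τ ≤ i := by
      obtain ⟨h1, m, hm, h2⟩ := h
      exact ⟨not_le.mp fun h => (h1 τ h).not_gt hτ, (Nat.find_min' hex h2).trans hm⟩
    have hle (i : ℕ) : ∑ j ∈ Finset.range i, (2 : ℝ≥0∞) ^ j * (2 ^ i)⁻¹ *
        (stopSet g c j i).indicator (fun _ => 1) t
        ≤ if τ ≤ i then 2⁻¹ ^ (i - τ) else 0 := by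
      split_ifs with hi
      · calc _ ≤ ∑ j ∈ Finset.range i, if j ∈ Finset.range τ then
              (2 : ℝ≥0∞) ^ j * (2 ^ i)⁻¹ else 0 := by
              refine Finset.sum_le_sum fun j _ => ?_
              by_cases ht : t ∈ stopSet g c j i
              · simp [ht, (hmem ht).1]
              · simp [ht]
          _ ≤ ∑ j ∈ Finset.range τ, (2 : ℝ≥0∞) ^ j * (2 ^ i)⁻¹ := by
              rw [← Finset.sum_filter]
              exact Finset.sum_le_sum_of_subset fun j hj => (Finset.mem_filter.mp hj).2
          _ = ((∑ j ∈ Finset.range τ, 2 ^ j : ℕ) : ℝ≥0∞) * (2 ^ i)⁻¹ := by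
              rw [← Finset.sum_mul]; push_cast; rfl
          _ ≤ 2 ^ τ * (2 ^ i)⁻¹ := by
              gcongr
              exact_mod_cast (Nat.geomSum_lt le_rfl fun j hj => Finset.mem_range.mp hj).le
          _ = 2⁻¹ ^ (i - τ) := by
              obtain ⟨k, rfl⟩ := Nat.exists_eq_add_of_le hi
              rw [pow_add, ENNReal.mul_inv (by simp) (by simp), ← mul_assoc,
                ENNReal.mul_inv_cancel (by simp) (by simp), one_mul, Nat.add_sub_cancel_left,
                ENNReal.inv_pow]
      · refine (Finset.sum_eq_zero fun j _ => ?_).le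
        rw [indicator_of_notMem fun h => hi (hmem h).2, mul_zero]
    refine (ENNReal.tsum_le_tsum hle).trans ?_
    rw [← ENNReal.summable.sum_add_tsum_nat_add' (k := τ), Finset.sum_eq_zero, zero_add]
    · simp [ENNReal.tsum_geometric, ENNReal.one_sub_inv_two]
    · intro i hi
      rw [if_neg (by simpa using hi)]
  · have (i j : ℕ) : t ∉ stopSet g c j i := fun h => hex (h.2.imp fun _ h => h.2)
    simp [this]

/-- The exceptional part of the flipped averages. -/
def stopSum (g : ℝ → ℝ≥0∞) (c : ℝ≥0∞) (x : ℝ) : ℝ≥0∞ :=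
  ∑' i, ∑ j ∈ Finset.range i, (2 : ℝ≥0∞) ^ j * (2 ^ i)⁻¹ *
    flipAvg i j ((stopSet g c j i).indicator g) x

theorem measurable_stopSum {g : ℝ → ℝ≥0∞} (hg : Measurable g) (c : ℝ≥0∞) :
    Measurable (stopSum g c) := by
  unfold stopSum
  have (i j : ℕ) : Measurable (flipAvg i j ((stopSet g c j i).indicator g)) :=
    measurable_flipAvg i j (hg.indicator (measurableSet_stopSet hg c j i))
  fun_prop

theorem lintegral_stopSum_le {g : ℝ → ℝ≥0∞} (hg : Measurable g) (c : ℝ≥0∞) :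
    ∫⁻ x in Ico (0 : ℝ) 1, stopSum g c x ≤ 2 * ∫⁻ x in Ico (0 : ℝ) 1, g x := by
  have hgs (i j : ℕ) : Measurable ((stopSet g c j i).indicator g) :=
    hg.indicator (measurableSet_stopSet hg c j i)
  have hm (i j : ℕ) : Measurable (flipAvg i j ((stopSet g c j i).indicator g)) :=
    measurable_flipAvg i j (hgs i j)
  unfold stopSum
  rw [lintegral_tsum fun i => by fun_prop]
  have h (i : ℕ) : ∫⁻ x in Ico (0 : ℝ) 1, ∑ j ∈ Finset.range i, (2 : ℝ≥0∞) ^ j * (2 ^ i)⁻¹ *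
      flipAvg i j ((stopSet g c j i).indicator g) x
      = ∫⁻ x in Ico (0 : ℝ) 1, (∑ j ∈ Finset.range i, (2 : ℝ≥0∞) ^ j * (2 ^ i)⁻¹ *
      (stopSet g c j i).indicator (fun _ => 1) x) * g x := by
    simp only [Finset.sum_mul]
    rw [lintegral_finsetSum _ fun j _ => by fun_prop, lintegral_finsetSum]
    · refine Finset.sum_congr rfl fun j hj => ?_
      rw [lintegral_const_mul _ (hm i j), lintegral_flipAvg (Finset.mem_range.mp hj) (hgs i j),
        ← lintegral_const_mul _ (hgs i j)]
      refine lintegral_congr fun x => ?_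
      by_cases hx : x ∈ stopSet g c j i <;> simp [hx]
    · intro j _
      have : Measurable ((stopSet g c j i).indicator fun _ => (1 : ℝ≥0∞)) :=
        measurable_const.indicator (measurableSet_stopSet hg c j i)
      fun_prop
  simp only [h]
  rw [← lintegral_tsum, ← lintegral_const_mul _ hg]
  · refine lintegral_mono fun x => ?_
    rw [ENNReal.tsum_mul_right]
    gcongr
    exact tsum_stopSet_le g c x
  · intro i
    have (j : ℕ) : Measurable ((stopSet g c j i).indicator fun _ => (1 : ℝ≥0∞)) :=
      measurable_const.indicator (measurableSet_stopSet hg c j i)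
    fun_prop

/-- The flipped average is an ordinary average over one interval of rank `i`. If it exceeds `c`, it
does so seen from every point `t` of that interval. Since `t` shares the first `j` digits of `x`,
its averages of rank at most `j` are those of `x`, so `t` lies in the stopping set. -/
theorem flipAvg_le {g : ℝ → ℝ≥0∞} {c : ℝ≥0∞} {x : ℝ} (hx : ∀ m, dyadicAvg m g x ≤ c) {i j : ℕ}
    (hj : j < i) : flipAvg i j g x ≤ c + flipAvg i j ((stopSet g c j i).indicator g) x := by
  by_cases hex : ∃ s, flipKernel i j x s ≠ 0 ∧ dyadicAvg i g s ≤ c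
  · obtain ⟨s, hs, hsc⟩ := hex
    refine le_add_right ?_
    simp only [flipAvg, flipKernel_eq_dyadicKernel hj hs]
    exact hsc
  · push Not at hex
    refine le_add_left (lintegral_mono fun t => ?_)
    by_cases h0 : flipKernel i j x t = 0
    · simp [h0]
    · have ht : t ∈ stopSet g c j i := by
        refine ⟨fun m hm => ?_, i, le_rfl, hex t h0⟩
        rw [← dyadicAvg_congr (x := x)]
        · exact hx m
        · intro l hl
          exact (flipKernel_ne_zero h0).2 l (by omega) (by omega)
      rw [indicator_of_mem ht]

theorem lintegral_fejerMajorant (B : ℕ) {g : ℝ → ℝ≥0∞} (hg : Measurable g) (x : ℝ) :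
    ∫⁻ t in Ico (0 : ℝ) 1, ENNReal.ofReal (fejerMajorant B x t) * g t
      = ∑ A ∈ Finset.range B, (2 * 2 ^ A * dyadicAvg A g x
        + ∑ j ∈ Finset.range A, 2 ^ j * flipAvg A j g x) := by
  have hD (A : ℕ) : Measurable fun t => ENNReal.ofReal (dyadicKernel A x t) :=
    ((measurable_dyadicKernel A).comp measurable_prodMk_left).ennreal_ofReal
  have hK (A j : ℕ) : Measurable fun t => ENNReal.ofReal (flipKernel A j x t) :=
    ((measurable_flipKernel A j).comp measurable_prodMk_left).ennreal_ofReal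
  have h (t : ℝ) : ENNReal.ofReal (fejerMajorant B x t) * g t
      = ∑ A ∈ Finset.range B, (2 * 2 ^ A * (ENNReal.ofReal (dyadicKernel A x t) * g t)
        + ∑ j ∈ Finset.range A, 2 ^ j * (ENNReal.ofReal (flipKernel A j x t) * g t)) := by
    have h0 (A : ℕ) : 0 ≤ ∑ j ∈ Finset.range A, 2 ^ j * flipKernel A j x t :=
      Finset.sum_nonneg fun j _ => mul_nonneg (by positivity) (flipKernel_nonneg _ _ _ _)
    have h1 (A : ℕ) : 0 ≤ 2 * 2 ^ A * dyadicKernel A x t :=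
      mul_nonneg (by positivity) (dyadicKernel_nonneg _ _ _)
    rw [fejerMajorant, ENNReal.ofReal_sum_of_nonneg fun A _ => add_nonneg (h1 A) (h0 A),
      Finset.sum_mul]
    refine Finset.sum_congr rfl fun A _ => ?_
    rw [ENNReal.ofReal_add (h1 A) (h0 A), ENNReal.ofReal_sum_of_nonneg fun j _ =>
      mul_nonneg (by positivity) (flipKernel_nonneg _ _ _ _), add_mul, Finset.sum_mul,
      ENNReal.ofReal_mul (by positivity), ENNReal.ofReal_mul (by positivity)]
    simp [ENNReal.ofReal_mul, mul_assoc]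
  simp only [h]
  rw [lintegral_finsetSum _ fun A _ => by fun_prop]
  refine Finset.sum_congr rfl fun A _ => ?_
  rw [lintegral_add_left (by fun_prop), lintegral_const_mul _ (by fun_prop),
    lintegral_finsetSum _ fun j _ => by fun_prop]
  congr 1
  exact Finset.sum_congr rfl fun j _ => lintegral_const_mul _ (by fun_prop)

theorem sum_two_pow_le (B : ℕ) : ∑ A ∈ Finset.range B, (2 : ℝ≥0∞) ^ A ≤ 2 ^ B := by
  exact_mod_cast (Nat.geomSum_lt le_rfl fun j hj => Finset.mem_range.mp hj).le

theorem lintegral_fejerMajorant_le {g : ℝ → ℝ≥0∞} (hg : Measurable g) {c : ℝ≥0∞} {x : ℝ}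
    (hx : ∀ m, dyadicAvg m g x ≤ c) (hx' : stopSum g c x ≤ c) (N : ℕ) :
    ∫⁻ t in Ico (0 : ℝ) 1, ENNReal.ofReal (fejerMajorant (N + 1) x t) * g t ≤ 7 * 2 ^ N * c := by
  rw [lintegral_fejerMajorant _ hg]
  set u : ℕ → ℕ → ℝ≥0∞ := fun A j => flipAvg A j ((stopSet g c j A).indicator g) x
  have h1 (A : ℕ) : ∑ j ∈ Finset.range A, 2 ^ j * flipAvg A j g x
      ≤ 2 ^ A * c + ∑ j ∈ Finset.range A, 2 ^ j * u A j := by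
    calc _ ≤ ∑ j ∈ Finset.range A, (2 ^ j * c + 2 ^ j * u A j) := by
          refine Finset.sum_le_sum fun j hj => ?_
          rw [← mul_add]
          gcongr
          exact flipAvg_le hx (Finset.mem_range.mp hj)
      _ ≤ _ := by
          rw [Finset.sum_add_distrib, ← Finset.sum_mul]
          gcongr
          exact sum_two_pow_le A
  -- Since `A ≤ N`, normalising by `2 ^ A` costs at most `2 ^ N` and leaves a piece of `stopSum`.
  have h2 (A : ℕ) (hA : A ∈ Finset.range (N + 1)) : ∑ j ∈ Finset.range A, 2 ^ j * u A j
      ≤ 2 ^ N * ∑ j ∈ Finset.range A, 2 ^ j * (2 ^ A)⁻¹ * u A j := by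
    rw [Finset.mul_sum]
    refine Finset.sum_le_sum fun j _ => ?_
    have hAN : A ≤ N := Nat.lt_succ_iff.mp (Finset.mem_range.mp hA)
    calc 2 ^ j * u A j = 2 ^ A * (2 ^ A)⁻¹ * (2 ^ j * u A j) := by
          rw [ENNReal.mul_inv_cancel (by simp) (by simp), one_mul]
      _ ≤ 2 ^ N * (2 ^ A)⁻¹ * (2 ^ j * u A j) := by
          gcongr
          exact one_le_two
      _ = _ := by ring
  calc _ ≤ ∑ A ∈ Finset.range (N + 1), (2 ^ A * (3 * c)
        + 2 ^ N * ∑ j ∈ Finset.range A, 2 ^ j * (2 ^ A)⁻¹ * u A j) := by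
        refine Finset.sum_le_sum fun A hA => ?_
        calc _ ≤ 2 * 2 ^ A * c + (2 ^ A * c + ∑ j ∈ Finset.range A, 2 ^ j * u A j) := by
              gcongr
              exacts [hx A, h1 A]
          _ = 2 ^ A * (3 * c) + ∑ j ∈ Finset.range A, 2 ^ j * u A j := by ring
          _ ≤ _ := by
              gcongr
              exact h2 A hA
    _ ≤ 2 ^ (N + 1) * (3 * c) + 2 ^ N * stopSum g c x := by
        rw [Finset.sum_add_distrib, ← Finset.sum_mul, ← Finset.mul_sum]
        gcongr
        · exact sum_two_pow_le _
        · exact ENNReal.sum_le_tsum _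
    _ ≤ 2 ^ (N + 1) * (3 * c) + 2 ^ N * c := by gcongr
    _ = _ := by ring

/-- The constant 3 is 1 from the dyadic maximal function plus 2 from Markov's inequality for
`stopSum`. -/
theorem exists_weak_type_bound {g : ℝ → ℝ≥0∞} (hg : Measurable g) (c : ℝ≥0∞) :
    ∃ Z : Set ℝ, c * volume.restrict (Ico (0 : ℝ) 1) Z ≤ 3 * ∫⁻ x in Ico (0 : ℝ) 1, g x ∧
      ∀ x ∉ Z, ∀ N, ∫⁻ t in Ico (0 : ℝ) 1, ENNReal.ofReal (fejerMajorant (N + 1) x t) * g t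
        ≤ 7 * 2 ^ N * c := by
  refine ⟨{x | ∃ m, c < dyadicAvg m g x} ∪ {x | c ≤ stopSum g c x}, ?_, fun x hx N => ?_⟩
  · refine (mul_le_mul_right (measure_union_le _ _) c).trans ?_
    rw [mul_add]
    calc _ ≤ (∫⁻ x in Ico (0 : ℝ) 1, g x) + ∫⁻ x in Ico (0 : ℝ) 1, stopSum g c x :=
          add_le_add (mul_measure_dyadicMaximal_le hg c)
            (mul_meas_ge_le_lintegral₀ (measurable_stopSum hg c).aemeasurable c)
      _ ≤ (∫⁻ x in Ico (0 : ℝ) 1, g x) + 2 * ∫⁻ x in Ico (0 : ℝ) 1, g x := by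
          gcongr
          exact lintegral_stopSum_le hg c
      _ = _ := by ring
  · simp only [mem_union, mem_ofPred_eq, not_or, not_exists, not_lt, not_le] at hx
    exact lintegral_fejerMajorant_le hg hx.1 hx.2.le N

/-! ### Partial sums as integrals -/

section

variable {𝕜 : Type*} [RCLike 𝕜] {f g : ℝ → 𝕜}

theorem integrableOn_smul_of_bounded {K : ℝ → ℝ} (hK : Measurable K) {C : ℝ}
    (hC : ∀ x, |K x| ≤ C) (hf : IntegrableOn f (Ico (0 : ℝ) 1)) :
    IntegrableOn (fun x => K x • f x) (Ico (0 : ℝ) 1) :=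
  Integrable.bdd_smul (C := C) hf hK.aestronglyMeasurable (Eventually.of_forall hC)

theorem integrableOn_walsh_smul (n : ℕ) (hf : IntegrableOn f (Ico (0 : ℝ) 1)) :
    IntegrableOn (fun x => walsh n x • f x) (Ico (0 : ℝ) 1) :=
  integrableOn_smul_of_bounded (measurable_walsh n) (fun x => (abs_walsh n x).le) hf

theorem integrableOn_dirichletKernel_smul (n : ℕ) (x : ℝ) (hf : IntegrableOn f (Ico (0 : ℝ) 1)) :
    IntegrableOn (fun t => dirichletKernel n x t • f t) (Ico (0 : ℝ) 1) := by
  simp only [dirichletKernel, Finset.sum_smul, mul_smul]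
  exact integrable_finsetSum _ fun i _ => (integrableOn_walsh_smul i hf).smul (walsh i x)

theorem partialSum_eq_integral (hf : IntegrableOn f (Ico (0 : ℝ) 1)) (n : ℕ) (x : ℝ) :
    partialSum f n x = ∫ t in Ico (0 : ℝ) 1, dirichletKernel n x t • f t := by
  simp only [dirichletKernel, Finset.sum_smul, mul_smul, partialSum, walshCoeff]
  have hi (i : ℕ) :
      IntegrableOn (fun t => walsh i x • walsh i t • f t) (Ico (0 : ℝ) 1) :=
    (integrableOn_walsh_smul i hf).smul (walsh i x)
  rw [integral_finsetSum _ fun i _ => hi i]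
  exact Finset.sum_congr rfl fun i _ => (integral_smul _ _).symm

theorem sum_partialSum_eq_integral (hf : IntegrableOn f (Ico (0 : ℝ) 1)) (n : ℕ) (x : ℝ) :
    ∑ k ∈ Finset.range n, partialSum f k x
      = ∫ t in Ico (0 : ℝ) 1, fejerKernel n x t • f t := by
  simp only [fejerKernel, Finset.sum_smul, partialSum_eq_integral hf]
  rw [integral_finsetSum _ fun i _ => integrableOn_dirichletKernel_smul i x hf]

theorem walshCoeff_sub (hf : IntegrableOn f (Ico (0 : ℝ) 1)) (hg : IntegrableOn g (Ico (0 : ℝ) 1))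
    (n : ℕ) : walshCoeff (fun x => f x - g x) n = walshCoeff f n - walshCoeff g n := by
  simp only [walshCoeff, smul_sub]
  exact integral_sub (integrableOn_walsh_smul n hf) (integrableOn_walsh_smul n hg)

theorem partialSum_sub (hf : IntegrableOn f (Ico (0 : ℝ) 1)) (hg : IntegrableOn g (Ico (0 : ℝ) 1))
    (n : ℕ) (x : ℝ) : partialSum (fun x => f x - g x) n x = partialSum f n x - partialSum g n x := by
  simp only [partialSum, walshCoeff_sub hf hg, smul_sub, Finset.sum_sub_distrib]

theorem vpMean_sub (lam : ℕ → ℕ) (hf : IntegrableOn f (Ico (0 : ℝ) 1))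
    (hg : IntegrableOn g (Ico (0 : ℝ) 1)) (n : ℕ) (x : ℝ) :
    vpMean lam (fun x => f x - g x) n x = vpMean lam f n x - vpMean lam g n x := by
  simp only [vpMean, partialSum_sub hf hg, Finset.sum_sub_distrib, smul_sub]

theorem vpMean_eq_sub (lam : ℕ → ℕ) (f : ℝ → 𝕜) (n : ℕ) (x : ℝ) :
    vpMean lam f n x = ((lam n : ℝ) + 1)⁻¹ • (∑ k ∈ Finset.range (n + 1), partialSum f k x
      - ∑ k ∈ Finset.range (n - lam n), partialSum f k x) := by
  rw [vpMean, ← Finset.sum_Ico_eq_sub _ (by omega)]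
  rfl

theorem exists_sum_partialSum_bound (hf : IntegrableOn f (Ico (0 : ℝ) 1)) {c : ℝ} (hc : 0 ≤ c) :
    ∃ Z : Set ℝ, ENNReal.ofReal c * volume.restrict (Ico (0 : ℝ) 1) Z
        ≤ 3 * ∫⁻ x in Ico (0 : ℝ) 1, ‖f x‖ₑ ∧
      ∀ x ∉ Z, ∀ n : ℕ, ‖∑ k ∈ Finset.range n, partialSum f k x‖ ≤ 7 * n * c := by
  have hae : AEMeasurable (fun x => ‖f x‖ₑ) (volume.restrict (Ico (0 : ℝ) 1)) := hf.1.enorm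
  obtain ⟨Z, hZ, hZ'⟩ := exists_weak_type_bound hae.measurable_mk (ENNReal.ofReal c)
  rw [← lintegral_congr_ae hae.ae_eq_mk] at hZ
  refine ⟨Z, hZ, fun x hx n => ?_⟩
  rcases Nat.eq_zero_or_pos n with rfl | hn
  · simp
  -- With `N = Nat.log 2 n`, the majorant of rank `N + 1` covers `n`, while its bound in `2 ^ N` is
  -- at most linear in `n`.
  have h1 : n < 2 ^ (Nat.log 2 n + 1) := Nat.lt_pow_succ_log_self (by norm_num) n
  have h2 : 2 ^ Nat.log 2 n ≤ n := Nat.pow_log_le_self 2 hn.ne'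
  have h3 : ‖∑ k ∈ Finset.range n, partialSum f k x‖ₑ ≤ 7 * 2 ^ Nat.log 2 n * ENNReal.ofReal c := by
    rw [sum_partialSum_eq_integral hf]
    refine (enorm_integral_le_lintegral_enorm _).trans (le_trans ?_ (hZ' x hx (Nat.log 2 n)))
    refine lintegral_mono_ae ?_
    filter_upwards [hae.ae_eq_mk] with t ht
    rw [← ht, enorm_smul]
    gcongr
    rw [Real.enorm_eq_ofReal_abs]
    exact ENNReal.ofReal_le_ofReal (abs_fejerKernel_le h1 x t)
  have h4 : (7 * 2 ^ Nat.log 2 n * ENNReal.ofReal c : ℝ≥0∞) ≤ ENNReal.ofReal (7 * n * c) := by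
    rw [ENNReal.ofReal_mul (by positivity), ENNReal.ofReal_mul (by positivity)]
    gcongr
    · simp
    · rw [ENNReal.ofReal_natCast]
      exact_mod_cast h2
  have h5 := h3.trans h4
  rw [← ofReal_norm] at h5
  exact (ENNReal.ofReal_le_ofReal_iff (by positivity)).mp h5

/-! ### Approximation by Walsh polynomials -/

theorem floor_eq_of_agreeTo {K : ℕ} {x t : ℝ} (hx : x ∈ Ico (0 : ℝ) 1) (ht : t ∈ Ico (0 : ℝ) 1)
    (h : AgreeTo K x t) : ⌊(2 : ℝ) ^ K * x⌋ = ⌊(2 : ℝ) ^ K * t⌋ := by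
  induction K with
  | zero => simp [Int.floor_eq_zero_iff.mpr hx, Int.floor_eq_zero_iff.mpr ht]
  | succ K ih =>
    have ih := ih (h.mono K.le_succ)
    have key (y : ℝ) : ⌊(2 : ℝ) ^ (K + 1) * y⌋ = 2 * ⌊(2 : ℝ) ^ K * y⌋ ∨
        ⌊(2 : ℝ) ^ (K + 1) * y⌋ = 2 * ⌊(2 : ℝ) ^ K * y⌋ + 1 := by
      have h1 := Int.floor_le ((2 : ℝ) ^ K * y)
      have h2 := Int.lt_floor_add_one ((2 : ℝ) ^ K * y)
      have h3 : 2 * ⌊(2 : ℝ) ^ K * y⌋ ≤ ⌊(2 : ℝ) ^ (K + 1) * y⌋ := by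
        rw [Int.le_floor, pow_succ]; push_cast; linarith
      have h4 : ⌊(2 : ℝ) ^ (K + 1) * y⌋ < 2 * ⌊(2 : ℝ) ^ K * y⌋ + 2 := by
        rw [Int.floor_lt, pow_succ]; push_cast; linarith
      omega
    have hr := h K K.lt_succ_self
    unfold rademacher at hr
    have hodd (a : ℤ) : (-1 : ℝ) ^ (2 * a + 1) = -1 := by
      rw [zpow_add_one₀ (by norm_num), zpow_mul]; simp
    have heven (a : ℤ) : (-1 : ℝ) ^ (2 * a) = 1 := by
      rw [zpow_mul]; simp
    rcases key x with h1 | h1 <;> rcases key t with h2 | h2 <;> rw [h1, h2] at hr ⊢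
    · omega
    · rw [hodd, heven] at hr; norm_num at hr
    · rw [hodd, heven] at hr; norm_num at hr
    · omega

theorem abs_sub_lt_of_agreeTo {K : ℕ} {x t : ℝ} (hx : x ∈ Ico (0 : ℝ) 1)
    (ht : t ∈ Ico (0 : ℝ) 1) (h : AgreeTo K x t) : |x - t| < (1 / 2) ^ K := by
  have h1 := Int.abs_sub_lt_one_of_floor_eq_floor (floor_eq_of_agreeTo hx ht h)
  rw [← mul_sub, abs_mul, abs_of_pos (by positivity)] at h1
  rw [one_div, inv_pow, ← one_div, lt_div_iff₀ (by positivity)]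
  linarith

theorem norm_sub_partialSum_le (hgi : IntegrableOn g (Ico (0 : ℝ) 1)) {K : ℕ} {ε : ℝ}
    (hK : ∀ x ∈ Ico (0 : ℝ) 1, ∀ t ∈ Ico (0 : ℝ) 1, AgreeTo K x t → ‖g x - g t‖ ≤ ε)
    {x : ℝ} (hx : x ∈ Ico (0 : ℝ) 1) : ‖g x - partialSum g (2 ^ K) x‖ ≤ ε := by
  have hD : IntegrableOn (dyadicKernel K x) (Ico (0 : ℝ) 1) :=
    Integrable.of_integral_ne_zero (by rw [integral_dyadicKernel]; exact one_ne_zero)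
  have h1 : g x = ∫ t in Ico (0 : ℝ) 1, dyadicKernel K x t • g x := by
    rw [integral_smul_const, integral_dyadicKernel, one_smul]
  have hi := integrableOn_dirichletKernel_smul (2 ^ K) x hgi
  rw [partialSum_eq_integral hgi]
  simp only [dirichletKernel_two_pow] at hi ⊢
  nth_rw 1 [h1]
  rw [← integral_sub (hD.smul_const _) hi]
  refine (norm_integral_le_integral_norm _).trans ?_
  calc _ ≤ ∫ t in Ico (0 : ℝ) 1, dyadicKernel K x t * ε := by
        refine setIntegral_mono_on ((hD.smul_const _).sub hi).norm (hD.mul_const _)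
          measurableSet_Ico fun t ht => ?_
        rw [← smul_sub, norm_smul, Real.norm_of_nonneg (dyadicKernel_nonneg _ _ _)]
        by_cases h0 : dyadicKernel K x t = 0
        · simp [h0]
        · have := hK x hx t ht ((dyadicKernel_ne_zero_iff K x t).mp h0)
          have := dyadicKernel_nonneg K x t
          gcongr
    _ = ε := by rw [integral_mul_const, integral_dyadicKernel, one_mul]

theorem walshCoeff_sum_walsh_smul (s : Finset ℕ) (a : ℕ → 𝕜) (n : ℕ) :
    walshCoeff (fun x => ∑ k ∈ s, walsh k x • a k) n = if n ∈ s then a n else 0 := by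
  have hint (k : ℕ) : IntegrableOn (fun x => (walsh n x * walsh k x) • a k) (Ico (0 : ℝ) 1) := by
    refine Integrable.smul_const ?_ _
    refine integrableOn_of_bounded (by fun_prop) (C := 1) fun x => ?_
    rw [abs_mul, abs_walsh, abs_walsh, one_mul]
  simp only [walshCoeff, Finset.smul_sum, smul_smul]
  rw [integral_finsetSum _ fun k _ => hint k]
  simp only [integral_smul_const, integral_walsh_mul_walsh, ite_smul, one_smul, zero_smul,
    Finset.sum_ite_eq]

theorem integrableOn_sum_walsh_smul (s : Finset ℕ) (a : ℕ → 𝕜) :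
    IntegrableOn (fun x => ∑ k ∈ s, walsh k x • a k) (Ico (0 : ℝ) 1) :=
  integrable_finsetSum _ fun k _ => Integrable.smul_const
    (integrableOn_of_bounded (measurable_walsh k) fun x => (abs_walsh k x).le) _

theorem integrableOn_partialSum (f : ℝ → 𝕜) (n : ℕ) :
    IntegrableOn (partialSum f n) (Ico (0 : ℝ) 1) :=
  integrableOn_sum_walsh_smul _ _

theorem partialSum_partialSum (f : ℝ → 𝕜) {m n : ℕ} (h : m ≤ n) (x : ℝ) :
    partialSum (partialSum f m) n x = partialSum f m x := by
  have h1 (k : ℕ) : walshCoeff (partialSum f m) k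
      = if k ∈ Finset.range m then walshCoeff f k else 0 :=
    walshCoeff_sum_walsh_smul _ _ k
  rw [partialSum, partialSum]
  simp only [h1, smul_ite, smul_zero]
  rw [← Finset.sum_filter]
  congr 1
  ext k
  simp only [Finset.mem_filter, Finset.mem_range]
  omega

/-- A continuous compactly supported approximant is replaced by its partial sum of order `2 ^ K`,
that is, by its averages over dyadic intervals. Uniform continuity makes this change uniformly small
on `[0,1)`. -/
theorem exists_partialSum_approx (hf : IntegrableOn f (Ico (0 : ℝ) 1)) {ε : ℝ} (hε : 0 < ε) :
    ∃ (g : ℝ → 𝕜) (m : ℕ), IntegrableOn g (Ico (0 : ℝ) 1) ∧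
      (∀ n ≥ m, ∀ x, partialSum g n x = g x) ∧
      ∫⁻ x in Ico (0 : ℝ) 1, ‖f x - g x‖ₑ ≤ ENNReal.ofReal ε := by
  obtain ⟨g, hgs, hgε, hgc, hgi⟩ :=
    Integrable.exists_hasCompactSupport_lintegral_sub_le hf (ε := ENNReal.ofReal (ε / 2))
      (by simpa using hε)
  obtain ⟨δ, hδ, hu⟩ := Metric.uniformContinuous_iff.mp
    (hgs.uniformContinuous_of_continuous hgc) (ε / 2) (by positivity)
  obtain ⟨K, hK⟩ := exists_pow_lt_of_lt_one hδ (by norm_num : (1 / 2 : ℝ) < 1)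
  have happ : ∀ x ∈ Ico (0 : ℝ) 1, ‖g x - partialSum g (2 ^ K) x‖ ≤ ε / 2 := fun x hx =>
    norm_sub_partialSum_le hgi (fun y hy t ht hyt => by
      rw [← dist_eq_norm]
      refine (hu ?_).le
      rw [Real.dist_eq]
      exact (abs_sub_lt_of_agreeTo hy ht hyt).trans hK) hx
  refine ⟨partialSum g (2 ^ K), 2 ^ K, integrableOn_partialSum _ _,
    fun n hn x => partialSum_partialSum g hn x, ?_⟩
  calc _ ≤ ∫⁻ x in Ico (0 : ℝ) 1, (‖f x - g x‖ₑ + ENNReal.ofReal (ε / 2)) := by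
        refine setLIntegral_mono_ae' measurableSet_Ico (Eventually.of_forall fun x hx => ?_)
        rw [← sub_add_sub_cancel (f x) (g x)]
        refine (enorm_add_le _ _).trans ?_
        gcongr
        rw [← ofReal_norm]
        exact ENNReal.ofReal_le_ofReal (happ x hx)
    _ = (∫⁻ x in Ico (0 : ℝ) 1, ‖f x - g x‖ₑ) + ENNReal.ofReal (ε / 2) := by
        rw [lintegral_add_right _ measurable_const]
        simp
    _ ≤ ENNReal.ofReal (ε / 2) + ENNReal.ofReal (ε / 2) := by
        gcongr
    _ = ENNReal.ofReal ε := by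
        rw [← ENNReal.ofReal_add (by positivity) (by positivity), add_halves]

theorem tendsto_vpMean_of_eventually_eq {lam : ℕ → ℕ} (hlam : ∀ n, 1 ≤ n → lam n ≤ n)
    (hlim : Tendsto lam atTop atTop) {m : ℕ} {x : ℝ} (h : ∀ n ≥ m, partialSum g n x = g x) :
    Tendsto (fun n => vpMean lam g n x) atTop (𝓝 (g x)) := by
  set M : ℝ := ∑ k ∈ Finset.range m, ‖partialSum g k x - g x‖
  rw [tendsto_iff_norm_sub_tendsto_zero]
  have hM : Tendsto (fun n => M / ((lam n : ℝ) + 1)) atTop (𝓝 0) :=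
    tendsto_const_nhds.div_atTop
      (tendsto_atTop_add_const_right _ _ (tendsto_natCast_atTop_atTop.comp hlim))
  refine squeeze_zero' (Eventually.of_forall fun n => norm_nonneg _) ?_ hM
  filter_upwards [eventually_ge_atTop 1] with n hn
  have hcard : ((lam n : ℝ) + 1)⁻¹ • ∑ k ∈ Finset.Icc (n - lam n) n, g x = g x := by
    have : n + 1 - (n - lam n) = lam n + 1 := by have := hlam n hn; omega
    rw [Finset.sum_const, Nat.card_Icc, this, ← Nat.cast_smul_eq_nsmul ℝ, smul_smul]
    push_cast
    rw [inv_mul_cancel₀ (by positivity), one_smul]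
  nth_rw 1 [← hcard]
  rw [vpMean, ← smul_sub, ← Finset.sum_sub_distrib, norm_smul, norm_inv,
    Real.norm_of_nonneg (by positivity), div_eq_inv_mul]
  gcongr
  refine (norm_sum_le _ _).trans ?_
  rw [← Finset.sum_filter_of_ne (p := (· < m))]
  · refine Finset.sum_le_sum_of_subset_of_nonneg (fun k hk => ?_) fun _ _ _ => norm_nonneg _
    exact Finset.mem_range.mpr (Finset.mem_filter.mp hk).2
  · intro k _ hne
    by_contra hk
    exact hne (by rw [h k (by omega), sub_self, norm_zero])

theorem ae_tendsto_vpMean {lam : ℕ → ℕ} (hlam : ∀ n, 1 ≤ n → lam n ≤ n)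
    (hO : (fun n : ℕ => (n : ℝ)) =O[atTop] fun n : ℕ => (lam n : ℝ))
    (hf : IntegrableOn f (Ico (0 : ℝ) 1)) :
    ∀ᵐ x ∂(volume.restrict (Ico (0 : ℝ) 1)),
      Tendsto (fun n => vpMean lam f n x) atTop (𝓝 (f x)) := by
  obtain ⟨C, hC1, hC⟩ := hO.exists_pos
  replace hC : ∀ᶠ n : ℕ in atTop, (n : ℝ) ≤ C * lam n := by
    filter_upwards [hC.bound] with n hn
    simpa using hn
  have hlim : Tendsto lam atTop atTop := by
    rw [← tendsto_natCast_atTop_iff (R := ℝ)]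
    refine tendsto_atTop_mono' _ (f₁ := fun n : ℕ => C⁻¹ * n) ?_
      (tendsto_natCast_atTop_atTop.const_mul_atTop (by positivity))
    filter_upwards [hC] with n hn
    rw [inv_mul_le_iff₀ hC1]
    exact hn
  -- Approximation errors `4 ^ (-k)` against thresholds `2 ^ (-k)` leave exceptional sets of measure
  -- at most `3 * 2 ^ (-k)`, which is summable.
  choose g m hg hgm hgε using fun k : ℕ =>
    exists_partialSum_approx hf (ε := (1 / 4 : ℝ) ^ k) (by positivity)
  choose Z hZ hZ' using fun k : ℕ => exists_sum_partialSum_bound (f := fun x => f x - g k x)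
    (hf.sub (hg k)) (c := (1 / 2 : ℝ) ^ k) (by positivity)
  set μ := volume.restrict (Ico (0 : ℝ) 1)
  have hdiv (k : ℕ) (s : Set ℝ) {a : ℝ≥0∞}
      (h : ENNReal.ofReal ((1 / 2) ^ k) * μ s ≤ a * ENNReal.ofReal ((1 / 4) ^ k)) :
      μ s ≤ a * 2⁻¹ ^ k := by
    have h2 : (1 / 4 : ℝ) ^ k = (1 / 2) ^ k * (1 / 2) ^ k := by rw [← mul_pow]; norm_num
    rw [h2, ENNReal.ofReal_mul (by positivity), mul_left_comm,
      ENNReal.mul_le_mul_iff_right (by simp) ENNReal.ofReal_ne_top] at h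
    refine h.trans_eq ?_
    rw [ENNReal.ofReal_pow (by positivity), one_div, ENNReal.ofReal_inv_of_pos (by positivity)]
    simp
  have hsum (a : ℝ≥0∞) (ha : a ≠ ⊤) : ∑' k : ℕ, a * (2⁻¹ : ℝ≥0∞) ^ k ≠ ⊤ := by
    rw [ENNReal.tsum_mul_left, ENNReal.tsum_geometric, ENNReal.one_sub_inv_two, inv_inv]
    finiteness
  have hA : ∀ᵐ x ∂μ, ∀ᶠ k in atTop, x ∉ Z k :=
    ae_eventually_notMem (ne_top_of_le_ne_top (hsum 3 (by simp)) (ENNReal.tsum_le_tsum fun k =>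
      hdiv k _ ((hZ k).trans (by gcongr; exact hgε k))))
  have hB : ∀ᵐ x ∂μ, ∀ᶠ k in atTop,
      x ∉ {x | ENNReal.ofReal ((1 / 2) ^ k) ≤ ‖f x - g k x‖ₑ} :=
    ae_eventually_notMem (ne_top_of_le_ne_top (hsum 1 (by simp)) (ENNReal.tsum_le_tsum fun k =>
      hdiv k _ ((mul_meas_ge_le_lintegral₀ (hf.sub (hg k)).1.enorm _).trans
        (by rw [one_mul]; exact hgε k))))
  filter_upwards [hA, hB] with x hxA hxB
  rw [Metric.tendsto_atTop]
  intro ε hε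
  have hk : ∀ᶠ k : ℕ in atTop, (14 * (C + 1) + 1) * (1 / 2 : ℝ) ^ k < ε / 2 := by
    have : Tendsto (fun k : ℕ => (14 * (C + 1) + 1) * (1 / 2 : ℝ) ^ k) atTop (𝓝 0) := by
      simpa using (tendsto_pow_atTop_nhds_zero_of_lt_one (by norm_num : (0 : ℝ) ≤ 1 / 2)
        (by norm_num)).const_mul (14 * (C + 1) + 1)
    exact this.eventually_lt_const (by positivity)
  obtain ⟨k, hk, hkA, hkB⟩ := (hk.and (hxA.and hxB)).exists
  have hkB' : ‖f x - g k x‖ ≤ (1 / 2) ^ k := by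
    rw [not_le, ← ofReal_norm] at hkB
    exact ((ENNReal.ofReal_lt_ofReal_iff (by positivity)).mp hkB).le
  have h1 := Metric.tendsto_atTop.mp (tendsto_vpMean_of_eventually_eq hlam hlim (x := x)
    fun n hn => hgm k n hn x) (ε / 2) (by positivity)
  obtain ⟨N1, hN1⟩ := h1
  obtain ⟨N2, hN2⟩ := eventually_atTop.mp hC
  refine ⟨max N1 N2, fun n hn => ?_⟩
  have h2 := hN1 n (le_of_max_le_left hn)
  have h3 := hN2 n (le_of_max_le_right hn)
  -- The two Fejér sums have at most `n + 1` and `n` terms, hence the bound `(14 n + 7) 2 ^ (-k)`.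
  -- Division by `lam n + 1` is absorbed by `n ≤ C * lam n`.
  have h4 : ‖vpMean lam f n x - vpMean lam (g k) n x‖ ≤ 14 * (C + 1) * (1 / 2) ^ k := by
    rw [← vpMean_sub lam hf (hg k), vpMean_eq_sub, norm_smul, norm_inv,
      Real.norm_of_nonneg (by positivity), inv_mul_le_iff₀ (by positivity)]
    refine (norm_sub_le _ _).trans ?_
    have h5 := hZ' k x hkA (n + 1)
    have h6 := hZ' k x hkA (n - lam n)
    have h7 : ((n - lam n : ℕ) : ℝ) ≤ n := by exact_mod_cast Nat.sub_le _ _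
    have h8 : (0 : ℝ) < (1 / 2) ^ k := by positivity
    have h9 : (0 : ℝ) ≤ lam n := by positivity
    push_cast at h5
    calc _ ≤ 7 * (n + 1) * (1 / 2) ^ k + 7 * n * (1 / 2 : ℝ) ^ k :=
          add_le_add h5 (h6.trans (by gcongr))
      _ = (14 * n + 7) * (1 / 2) ^ k := by ring
      _ ≤ ((lam n + 1) * (14 * (C + 1))) * (1 / 2) ^ k := by
          gcongr
          nlinarith
      _ = _ := by ring
  rw [dist_eq_norm] at h2 ⊢
  have h5 : vpMean lam f n x - f x = (vpMean lam f n x - vpMean lam (g k) n x)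
      + (vpMean lam (g k) n x - g k x) - (f x - g k x) := by ring
  rw [h5]
  have h6 := norm_sub_le ((vpMean lam f n x - vpMean lam (g k) n x)
      + (vpMean lam (g k) n x - g k x)) (f x - g k x)
  have h7 := norm_add_le (vpMean lam f n x - vpMean lam (g k) n x)
      (vpMean lam (g k) n x - g k x)
  linarith

end

/-! ### Riesz products of blocks of digits -/

theorem partialSum_two_pow_eq {Q : ℕ} {u : ℝ → ℝ} (hu : IntegrableOn u (Ico (0 : ℝ) 1))
    (hQ : ∀ x y, AgreeTo Q x y → u x = u y) (x : ℝ) : partialSum u (2 ^ Q) x = u x := by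
  rw [partialSum_eq_integral hu]
  simpa only [dirichletKernel_two_pow, smul_eq_mul] using integral_dyadicKernel_mul hQ x

/-- The spectrum of `u` lies below `2 ^ Q`. The dilated factor shifts it by `2 ^ Q * ofBits V > 0`,
away from frequency 0. -/
theorem integral_radProd_mul_eq_zero {Q : ℕ} {u : ℝ → ℝ} (hu : IntegrableOn u (Ico (0 : ℝ) 1))
    (hQ : ∀ x y, AgreeTo Q x y → u x = u y) {V : Finset ℕ} (hV : V.Nonempty) :
    ∫ x in Ico (0 : ℝ) 1, radProd V (2 ^ Q * x) * u x = 0 := by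
  have hpos : 0 < ofBits V := Finset.sum_pos (fun _ _ => by positivity) hV
  have h (x : ℝ) : radProd V (2 ^ Q * x) * u x
      = ∑ k ∈ Finset.range (2 ^ Q), walshCoeff u k *
        (walsh (2 ^ Q * ofBits V + k) x * walsh 0 x) := by
    rw [← partialSum_two_pow_eq hu hQ x, partialSum, Finset.mul_sum]
    refine Finset.sum_congr rfl fun k hk => ?_
    rw [walsh_add _ (Finset.mem_range.mp hk), walsh_ofBits, walsh_zero, smul_eq_mul]
    ring
  simp only [h]
  rw [integral_finsetSum]
  · refine Finset.sum_eq_zero fun k _ => ?_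
    have : 0 < 2 ^ Q * ofBits V := by positivity
    rw [integral_const_mul, integral_walsh_mul_walsh, if_neg (by omega), mul_zero]
  · intro k _
    refine Integrable.const_mul (integrableOn_of_bounded (by fun_prop) (C := 1) fun x => ?_) _
    rw [abs_mul, abs_walsh, abs_walsh, one_mul]

theorem abs_dyadicKernel_le (j : ℕ) (x t : ℝ) : |dyadicKernel j x t| ≤ 2 ^ j := by
  rw [dyadicKernel, Finset.abs_prod]
  refine (Finset.prod_le_prod (fun _ _ => abs_nonneg _) (g := fun _ => (2 : ℝ))
    fun l _ => ?_).trans (by simp)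
  rcases rademacher_eq_or l x with h | h <;> rcases rademacher_eq_or l t with h' | h' <;>
    norm_num [h, h']

/-- Where the dyadic kernel of rank `A` is nonzero, all lower Rademacher factors at `x` and `t`
agree and cancel. Modulation thus turns a Dirichlet kernel into a sum of martingale difference
kernels over the digits in `J`, all with sign `+`. -/
theorem dirichletKernel_ofBits (J : Finset ℕ) (x t : ℝ) :
    dirichletKernel (ofBits J) x t * (radProd J x * radProd J t)
      = ∑ j ∈ J, rademacher j x * rademacher j t * dyadicKernel j x t := by
  induction J using Finset.induction_on_max with
  | empty => simp [ofBits, dirichletKernel]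
  | insert A S h ih =>
    have hA : A ∉ S := fun hA => (h A hA).false
    rw [ofBits_insert h, dirichletKernel_two_pow_add (ofBits_lt h).le, Finset.sum_insert hA, ← ih,
      dirichletKernel_two_pow]
    have h1 : radProd (insert A S) x = rademacher A x * radProd S x := Finset.prod_insert hA
    have h2 : radProd (insert A S) t = rademacher A t * radProd S t := Finset.prod_insert hA
    have h3 : dyadicKernel A x t * (radProd S x * radProd S t) = dyadicKernel A x t := by
      by_cases h0 : dyadicKernel A x t = 0
      · simp [h0]
      · have h4 : radProd S x = radProd S t :=
          Finset.prod_congr rfl fun l hl => (dyadicKernel_ne_zero_iff A x t).mp h0 l (h l hl)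
        rw [h4, radProd_mul_self, mul_one]
    rw [h1, h2]
    linear_combination (rademacher A x * rademacher A t) * h3
      + (dirichletKernel (ofBits S) x t * radProd S x * radProd S t * rademacher A t
          * rademacher A t) * rademacher_mul_self A x
      + (dirichletKernel (ofBits S) x t * radProd S x * radProd S t) * rademacher_mul_self A t

theorem abs_prod_eq_one {ι : Type*} {β : ι → ℝ → ℝ} (hβ : ∀ c x, β c x = 1 ∨ β c x = -1)
    (T : Finset ι) (x : ℝ) : |∏ c ∈ T, β c x| = 1 := by
  rw [Finset.abs_prod]
  refine Finset.prod_eq_one fun c _ => ?_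
  rcases hβ c x with h | h <;> simp [h]

section Riesz

variable {ι : Type*} [Fintype ι]

/-- The Riesz product `∏_c (1 + β_c r_{Q + e(c)})`. -/
def rieszProd (Q : ℕ) (e : ι ↪ ℕ) (β : ι → ℝ → ℝ) (x : ℝ) : ℝ :=
  ∏ c, (1 + β c x * rademacher (Q + e c) x)

variable {Q : ℕ} (e : ι ↪ ℕ) {β : ι → ℝ → ℝ}

theorem rieszProd_eq_sum (x : ℝ) :
    rieszProd Q e β x = ∑ T : Finset ι, (∏ c ∈ T, β c x) * radProd (T.map e) (2 ^ Q * x) := by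
  rw [rieszProd, Finset.prod_one_add, Finset.powerset_univ]
  refine Finset.sum_congr rfl fun T _ => ?_
  rw [Finset.prod_mul_distrib, radProd, Finset.prod_map]
  simp only [rademacher_two_pow_mul]

theorem rieszProd_eq_or (hβ : ∀ c x, β c x = 1 ∨ β c x = -1) (x : ℝ) :
    rieszProd Q e β x = 0 ∨ rieszProd Q e β x = 2 ^ Fintype.card ι := by
  by_cases h : ∃ c, 1 + β c x * rademacher (Q + e c) x = 0
  · obtain ⟨c, hc⟩ := h
    exact Or.inl (Finset.prod_eq_zero (Finset.mem_univ c) hc)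
  · right
    push Not at h
    rw [rieszProd, Finset.prod_congr rfl (g := fun _ => (2 : ℝ)), Finset.prod_const,
      Finset.card_univ]
    intro c _
    have := h c
    rcases hβ c x with h1 | h1 <;> rcases rademacher_eq_or (Q + e c) x with h2 | h2 <;>
      first
      | (rw [h1, h2]; norm_num; done)
      | exact absurd (by rw [h1, h2]; norm_num) this

/-- In the expanded Riesz product, the high digits of the frequency select the single term `T = S`
by orthogonality. The low digits then read off the spectrum of the subproduct. -/
theorem walshCoeff_rieszProd (hm : ∀ c, Measurable (β c)) (hβ : ∀ c x, β c x = 1 ∨ β c x = -1)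
    (hQ : ∀ c x y, AgreeTo Q x y → β c x = β c y) (S : Finset ι) {i : ℕ} (hi : i < 2 ^ Q) :
    walshCoeff (rieszProd Q e β) (2 ^ Q * ofBits (S.map e) + i)
      = walshCoeff (fun x => ∏ c ∈ S, β c x) i := by
  have hint (T : Finset ι) :
      IntegrableOn (fun x => walsh i x * ∏ c ∈ T, β c x) (Ico (0 : ℝ) 1) := by
    refine integrableOn_of_bounded (by fun_prop) (C := 1) fun x => ?_
    rw [abs_mul, abs_walsh, abs_prod_eq_one hβ, one_mul]
  have h (x : ℝ) : walsh (2 ^ Q * ofBits (S.map e) + i) x * rieszProd Q e β x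
      = ∑ T : Finset ι, radProd (symmDiff (S.map e) (T.map e)) (2 ^ Q * x) *
        (walsh i x * ∏ c ∈ T, β c x) := by
    rw [rieszProd_eq_sum, walsh_add _ hi, walsh_ofBits, Finset.mul_sum]
    refine Finset.sum_congr rfl fun T _ => ?_
    rw [← radProd_mul]
    ring
  simp only [walshCoeff, smul_eq_mul, h]
  rw [integral_finsetSum, Finset.sum_eq_single S]
  · simp [radProd]
  · intro T _ hT
    refine integral_radProd_mul_eq_zero (hint T) (fun x y hxy => ?_) ?_
    · rw [walsh_congr hi hxy, Finset.prod_congr rfl fun c _ => hQ c x y hxy]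
    · rw [Finset.nonempty_iff_ne_empty]
      intro h0
      have : S.map e = T.map e := by simpa using h0
      exact hT (Finset.map_injective e this).symm
  · simp
  · intro T _
    have hm1 : Measurable fun x : ℝ => radProd (symmDiff (S.map e) (T.map e)) (2 ^ Q * x) :=
      (measurable_radProd _).comp (measurable_id.const_mul _)
    refine integrableOn_of_bounded (by fun_prop) (C := 1) fun x => ?_
    rw [abs_mul, abs_mul, abs_walsh, abs_prod_eq_one hβ, abs_radProd]
    norm_num

theorem abs_sum_walshCoeff_rieszProd (hm : ∀ c, Measurable (β c))
    (hβ : ∀ c x, β c x = 1 ∨ β c x = -1) (hQ : ∀ c x y, AgreeTo Q x y → β c x = β c y)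
    (S : Finset ι) {J : Finset ℕ} (hJ : ∀ j ∈ J, j < Q) {G : ℝ → ℝ}
    (hG : ∀ t, ∏ c ∈ S, β c t = radProd J t * G t) (hGi : IntegrableOn G (Ico (0 : ℝ) 1)) (x : ℝ) :
    |∑ k ∈ Finset.Ico (2 ^ Q * ofBits (S.map e)) (2 ^ Q * ofBits (S.map e) + ofBits J),
      walsh k x * walshCoeff (rieszProd Q e β) k|
      = |∑ j ∈ J, ∫ t in Ico (0 : ℝ) 1,
          rademacher j x * rademacher j t * dyadicKernel j x t * G t| := by
  have hint : IntegrableOn (fun x => ∏ c ∈ S, β c x) (Ico (0 : ℝ) 1) :=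
    integrableOn_of_bounded (by fun_prop) fun x => (abs_prod_eq_one hβ S x).le
  have h1 : ∑ k ∈ Finset.Ico (2 ^ Q * ofBits (S.map e)) (2 ^ Q * ofBits (S.map e) + ofBits J),
      walsh k x * walshCoeff (rieszProd Q e β) k
      = walsh (ofBits (S.map e)) (2 ^ Q * x)
        * partialSum (fun x => ∏ c ∈ S, β c x) (ofBits J) x := by
    rw [Finset.sum_Ico_eq_sum_range, Nat.add_sub_cancel_left, partialSum, Finset.mul_sum]
    refine Finset.sum_congr rfl fun k hk => ?_
    have hk : k < 2 ^ Q := (Finset.mem_range.mp hk).trans (ofBits_lt hJ)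
    rw [walsh_add _ hk, walshCoeff_rieszProd e hm hβ hQ S hk, smul_eq_mul, mul_assoc]
  have h2 : partialSum (fun x => ∏ c ∈ S, β c x) (ofBits J) x
      = radProd J x * ∑ j ∈ J, ∫ t in Ico (0 : ℝ) 1,
          rademacher j x * rademacher j t * dyadicKernel j x t * G t := by
    have hkey (t : ℝ) : dirichletKernel (ofBits J) x t • ∏ c ∈ S, β c t = radProd J x *
        ∑ j ∈ J, rademacher j x * rademacher j t * dyadicKernel j x t * G t := by
      rw [← Finset.sum_mul, ← dirichletKernel_ofBits, hG t, smul_eq_mul]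
      linear_combination
        -(dirichletKernel (ofBits J) x t * radProd J t * G t) * radProd_mul_self J x
    rw [partialSum_eq_integral hint, integral_congr_ae (Eventually.of_forall hkey),
      integral_const_mul, integral_finsetSum]
    · intro j _
      have hD : Measurable (dyadicKernel j x) := by
        unfold dyadicKernel
        fun_prop
      have hK : Measurable fun t => rademacher j x * rademacher j t * dyadicKernel j x t := by
        fun_prop
      have hK1 (t : ℝ) : |rademacher j x * rademacher j t * dyadicKernel j x t| ≤ 2 ^ j := by
        rw [abs_mul, abs_mul, abs_rademacher, abs_rademacher, one_mul, one_mul]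
        exact abs_dyadicKernel_le j x t
      exact integrableOn_smul_of_bounded hK hK1 hGi
  rw [h1, h2, abs_mul, abs_mul, abs_walsh, abs_radProd, one_mul, one_mul]

end Riesz

/-! ### Windows of digits -/

/-- The indicator of the event that the digits `u, …, u + L - 1` of `x` and `t` agree. -/
def windowMatch (L u : ℕ) (x t : ℝ) : ℝ :=
  ∏ l ∈ Finset.range L, ((1 + rademacher (u + l) x * rademacher (u + l) t) / 2)

theorem windowMatch_eq_or (L u : ℕ) (x t : ℝ) :
    windowMatch L u x t = 0 ∨ windowMatch L u x t = 1 := by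
  unfold windowMatch
  induction L with
  | zero => simp
  | succ L ih =>
    rw [Finset.prod_range_succ]
    have h : (1 + rademacher (u + L) x * rademacher (u + L) t) / 2 = 0 ∨
        (1 + rademacher (u + L) x * rademacher (u + L) t) / 2 = 1 := by
      rcases rademacher_eq_or (u + L) x with h | h <;>
        rcases rademacher_eq_or (u + L) t with h' | h' <;> norm_num [h, h']
    rcases h with h | h <;> rw [h]
    · simp
    · simpa using ih

theorem windowMatch_eq_one {L u : ℕ} {x t : ℝ} (h : AgreeTo (u + L) x t) :
    windowMatch L u x t = 1 := by
  refine Finset.prod_eq_one fun l hl => ?_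
  rw [h (u + l) (by simpa using hl), rademacher_mul_self]
  norm_num

theorem windowMatch_eq_zero {L u j : ℕ} {x t : ℝ} (h : rademacher j t = -rademacher j x)
    (h1 : u ≤ j) (h2 : j < u + L) : windowMatch L u x t = 0 := by
  refine Finset.prod_eq_zero (i := j - u) (by simp; omega) ?_
  rw [Nat.add_sub_of_le h1, h, mul_neg, rademacher_mul_self]
  norm_num

@[fun_prop]
theorem measurable_windowMatch (L u : ℕ) (x : ℝ) : Measurable (windowMatch L u x) := by
  unfold windowMatch
  fun_prop

/-- `-1` to the number of windows, among the first `p` ones, where the digits agree. -/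
def windowSign (p L : ℕ) (x t : ℝ) : ℝ :=
  ∏ u ∈ Finset.range p, (1 - 2 * windowMatch L u x t)

theorem abs_one_sub_windowMatch (L u : ℕ) (x t : ℝ) : |1 - 2 * windowMatch L u x t| = 1 := by
  rcases windowMatch_eq_or L u x t with h | h <;> norm_num [h]

theorem abs_windowSign (p L : ℕ) (x t : ℝ) : |windowSign p L x t| = 1 := by
  rw [windowSign, Finset.abs_prod]
  simp [abs_one_sub_windowMatch]

@[fun_prop]
theorem measurable_windowSign (p L : ℕ) (x : ℝ) : Measurable (windowSign p L x) := by
  unfold windowSign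
  fun_prop

theorem abs_prod_sub_one_le {ι : Type*} (s : Finset ι) (b : ι → ℝ) (hb : ∀ i, |b i| ≤ 1) :
    |∏ i ∈ s, b i - 1| ≤ ∑ i ∈ s, |b i - 1| := by
  classical
  induction s using Finset.induction_on with
  | empty => simp
  | insert a s ha ih =>
    rw [Finset.prod_insert ha, Finset.sum_insert ha]
    have h : b a * ∏ i ∈ s, b i - 1 = (b a - 1) + b a * (∏ i ∈ s, b i - 1) := by ring
    rw [h]
    refine (abs_add_le _ _).trans ?_
    rw [abs_mul]
    have := mul_le_mul (hb a) ih (abs_nonneg _) zero_le_one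
    linarith

/-- The dyadic kernel of the sibling interval: the first `j` digits agree, the digit number `j`
does not. -/
def siblingKernel (j : ℕ) (x t : ℝ) : ℝ :=
  dyadicKernel j x t * (1 - rademacher j x * rademacher j t)

theorem siblingKernel_nonneg (j : ℕ) (x t : ℝ) : 0 ≤ siblingKernel j x t :=
  mul_nonneg (dyadicKernel_nonneg j x t) (one_sub_rademacher_mul_nonneg j x t)

/-- Digits after `j` are independent of the sibling condition. Written as one Riesz-type product,
this makes a later window match with probability `2 ^ (-L)` on the sibling interval. -/
theorem siblingKernel_mul_prod (j : ℕ) (x t : ℝ) {U : Finset ℕ} (hU : ∀ l ∈ U, j < l) :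
    siblingKernel j x t * ∏ l ∈ U, (1 + rademacher l x * rademacher l t)
      = ∏ l ∈ Finset.range (j + 1) ∪ U,
        (1 + (if l = j then -rademacher l x else rademacher l x) * rademacher l t) := by
  rw [Finset.prod_union, Finset.prod_range_succ, siblingKernel, dyadicKernel]
  · congr 1
    · congr 1
      · refine Finset.prod_congr rfl fun l hl => ?_
        rw [if_neg (Finset.mem_range.mp hl).ne]
      · rw [if_pos rfl]
        ring
    · refine Finset.prod_congr rfl fun l hl => ?_
      rw [if_neg (hU l hl).ne']
  · rw [Finset.disjoint_left]
    intro l hl hlU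
    have := hU l hlU
    have := Finset.mem_range.mp hl
    omega

theorem integral_siblingKernel (j : ℕ) (x : ℝ) :
    ∫ t in Ico (0 : ℝ) 1, siblingKernel j x t = 1 := by
  have h (t : ℝ) := siblingKernel_mul_prod j x t (U := ∅) (by simp)
  simp only [Finset.prod_empty, mul_one] at h
  simp only [h]
  exact integral_riesz _ _

theorem siblingKernel_mul_windowMatch {j u : ℕ} (hju : j < u) (L : ℕ) (x t : ℝ) :
    siblingKernel j x t * windowMatch L u x t
      = (2 ^ L)⁻¹ * ∏ l ∈ Finset.range (j + 1) ∪ Finset.Ico u (u + L),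
        (1 + (if l = j then -rademacher l x else rademacher l x) * rademacher l t) := by
  rw [← siblingKernel_mul_prod j x t (fun l hl => hju.trans_le (Finset.mem_Ico.mp hl).1),
    Finset.prod_Ico_eq_prod_range, Nat.add_sub_cancel_left, windowMatch, Finset.prod_div_distrib]
  simp
  ring

theorem integral_siblingKernel_mul_windowMatch {j u : ℕ} (hju : j < u) (L : ℕ) (x : ℝ) :
    ∫ t in Ico (0 : ℝ) 1, siblingKernel j x t * windowMatch L u x t = (2 ^ L)⁻¹ := by
  simp only [siblingKernel_mul_windowMatch hju]
  rw [integral_const_mul, integral_riesz, mul_one]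

theorem integrableOn_siblingKernel_mul (j : ℕ) (x : ℝ) {G : ℝ → ℝ} (hG : Measurable G)
    (hG1 : ∀ t, |G t| ≤ 1) :
    IntegrableOn (fun t => siblingKernel j x t * G t) (Ico (0 : ℝ) 1) := by
  have : IntegrableOn (siblingKernel j x) (Ico (0 : ℝ) 1) :=
    Integrable.of_integral_ne_zero (by rw [integral_siblingKernel]; exact one_ne_zero)
  exact this.mul_bdd (c := 1) hG.aestronglyMeasurable (Eventually.of_forall hG1)

theorem integrableOn_dyadicKernel_mul (j : ℕ) (x : ℝ) {G : ℝ → ℝ} (hG : Measurable G)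
    (hG1 : ∀ t, |G t| ≤ 1) :
    IntegrableOn (fun t => dyadicKernel j x t * G t) (Ico (0 : ℝ) 1) := by
  have : IntegrableOn (dyadicKernel j x) (Ico (0 : ℝ) 1) :=
    Integrable.of_integral_ne_zero (by rw [integral_dyadicKernel]; exact one_ne_zero)
  exact this.mul_bdd (c := 1) hG.aestronglyMeasurable (Eventually.of_forall hG1)

/-- On the sibling interval the digits of `t` agree with those of `x` before `j` and differ at `j`.
The windows `u < i` end before `j` and match, giving `(-1) ^ i`. Those containing `j` fail. Only
those starting after `j` are undetermined, and they are the error. -/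
theorem abs_windowSign_sub_le {p L j i : ℕ} (hi : i ≤ p) (hj : j + 1 = L + i) {x t : ℝ}
    (h : siblingKernel j x t ≠ 0) :
    |windowSign p L x t - (-1) ^ i|
      ≤ ∑ u ∈ Finset.range p with j < u, 2 * windowMatch L u x t := by
  obtain ⟨h1, h2⟩ := mul_ne_zero_iff.mp h
  rw [dyadicKernel_ne_zero_iff] at h1
  rw [one_sub_rademacher_mul_ne_zero_iff] at h2
  have hfac (u : ℕ) : 1 - 2 * windowMatch L u x t
      = (if u < i then -1 else 1) * (if j < u then 1 - 2 * windowMatch L u x t else 1) := by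
    by_cases hu : u < i
    · rw [windowMatch_eq_one (h1.mono (by omega)), if_pos hu,
        if_neg (by omega)]
      norm_num
    · rw [if_neg hu]
      by_cases hju : j < u
      · rw [if_pos hju, one_mul]
      · rw [if_neg hju, windowMatch_eq_zero h2 (by omega) (by omega)]
        norm_num
  have hsgn : ∏ u ∈ Finset.range p, (if u < i then (-1 : ℝ) else 1) = (-1) ^ i := by
    rw [← Finset.prod_filter, Finset.prod_const]
    congr 1
    have : Finset.filter (· < i) (Finset.range p) = Finset.range i := by
      ext u
      simp
      omega
    rw [this, Finset.card_range]
  rw [windowSign, Finset.prod_congr rfl fun u _ => hfac u, Finset.prod_mul_distrib, hsgn,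
    ← mul_sub_one, abs_mul, abs_pow, abs_neg, abs_one, one_pow, one_mul, Finset.sum_filter]
  refine (abs_prod_sub_one_le _ _ fun u => ?_).trans (Finset.sum_le_sum fun u _ => ?_)
  · split_ifs
    · rw [abs_one_sub_windowMatch]
    · simp
  · split_ifs
    · rcases windowMatch_eq_or L u x t with h | h <;> norm_num [h]
    · simp

theorem abs_integral_siblingKernel_windowSign_le {p L j i : ℕ} (hi : i ≤ p) (hj : j + 1 = L + i)
    (x : ℝ) : |(∫ t in Ico (0 : ℝ) 1, siblingKernel j x t * windowSign p L x t) - (-1) ^ i|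
      ≤ 2 * p * (2 ^ L)⁻¹ := by
  have hG := integrableOn_siblingKernel_mul j x (measurable_windowSign p L x)
    fun t => (abs_windowSign p L x t).le
  have h1 := integrableOn_siblingKernel_mul j x (G := fun _ => (-1) ^ i) measurable_const
    fun t => by simp
  have hW (u : ℕ) := integrableOn_siblingKernel_mul j x (measurable_windowMatch L u x)
    fun t => by rcases windowMatch_eq_or L u x t with h | h <;> norm_num [h]
  have e1 : ((-1) ^ i : ℝ) = ∫ t in Ico (0 : ℝ) 1, siblingKernel j x t * (-1) ^ i := by
    rw [integral_mul_const, integral_siblingKernel, one_mul]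
  rw [e1, ← integral_sub hG h1]
  refine (abs_integral_le_integral_abs).trans ?_
  calc _ ≤ ∫ t in Ico (0 : ℝ) 1, ∑ u ∈ Finset.range p with j < u,
          2 * (siblingKernel j x t * windowMatch L u x t) := by
        refine integral_mono (hG.sub h1).abs
          (integrable_finsetSum _ fun u _ => (hW u).const_mul 2) fun t => ?_
        dsimp only
        rw [← mul_sub, abs_mul, abs_of_nonneg (siblingKernel_nonneg j x t)]
        by_cases h0 : siblingKernel j x t = 0
        · simp [h0]
        · have := mul_le_mul_of_nonneg_left (abs_windowSign_sub_le hi hj h0)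
            (siblingKernel_nonneg j x t)
          refine this.trans_eq ?_
          rw [Finset.mul_sum]
          exact Finset.sum_congr rfl fun u _ => by ring
    _ = ∑ u ∈ Finset.range p with j < u, 2 * (2 ^ L)⁻¹ := by
        rw [integral_finsetSum _ fun u _ => (hW u).const_mul 2]
        refine Finset.sum_congr rfl fun u hu => ?_
        rw [integral_const_mul, integral_siblingKernel_mul_windowMatch (Finset.mem_filter.mp hu).2]
    _ ≤ ∑ u ∈ Finset.range p, 2 * (2 ^ L)⁻¹ :=
        Finset.sum_le_sum_of_subset_of_nonneg (Finset.filter_subset _ _)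
          fun _ _ _ => by positivity
    _ = _ := by
        rw [Finset.sum_const, Finset.card_range, nsmul_eq_mul]
        ring

theorem integral_dyadicKernel_mul_ge (j : ℕ) (x : ℝ) {G : ℝ → ℝ} (hG : Measurable G)
    (hG1 : ∀ t, |G t| ≤ 1) : -1 ≤ ∫ t in Ico (0 : ℝ) 1, dyadicKernel j x t * G t := by
  have h := integrableOn_dyadicKernel_mul j x (G := fun _ => -1) measurable_const (by simp)
  calc (-1 : ℝ) = ∫ t in Ico (0 : ℝ) 1, dyadicKernel j x t * -1 := by
        rw [integral_mul_const, integral_dyadicKernel, one_mul]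
    _ ≤ _ := integral_mono h (integrableOn_dyadicKernel_mul j x hG hG1) fun t =>
        mul_le_mul_of_nonneg_left (abs_le.mp (hG1 t)).1 (dyadicKernel_nonneg j x t)

theorem dyadicKernel_succ (j : ℕ) (x t : ℝ) : dyadicKernel (j + 1) x t
    = dyadicKernel j x t * (1 + rademacher j x * rademacher j t) := by
  rw [dyadicKernel, Finset.prod_range_succ, dyadicKernel]

/-- For odd `i` the mean of the sign is at most `-3/4` on the sibling at digit `j` and at least
`3/4` on the sibling at `j + 1`. The remaining interval of rank `j + 2`, where nothing is known,
contributes at least `-1`. In total, `-1/4 + 3/16 + 3/8 = 5/16`. -/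
theorem integral_windowSign_ge {p L j i : ℕ} (hi : i < p) (hodd : Odd i) (hj : j + 1 = L + i)
    (hpL : 2 * (p : ℝ) * (2 ^ L)⁻¹ ≤ 1 / 4) (x : ℝ) :
    1 / 4 ≤ ∫ t in Ico (0 : ℝ) 1,
      rademacher j x * rademacher j t * dyadicKernel j x t * windowSign p L x t := by
  have hm := measurable_windowSign p L x
  have hb (t : ℝ) : |windowSign p L x t| ≤ 1 := (abs_windowSign p L x t).le
  have hS (j : ℕ) := integrableOn_siblingKernel_mul j x hm hb
  have hD (j : ℕ) := integrableOn_dyadicKernel_mul j x hm hb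
  have h1 := (abs_le.mp ((abs_integral_siblingKernel_windowSign_le hi.le hj x).trans hpL)).2
  have h2 := (abs_le.mp ((abs_integral_siblingKernel_windowSign_le (j := j + 1) hi
    (by omega) x).trans hpL)).1
  have h3 := integral_dyadicKernel_mul_ge (j + 2) x hm hb
  rw [pow_succ, hodd.neg_one_pow] at h2
  rw [hodd.neg_one_pow] at h1
  -- The difference kernel is half of (own child minus sibling); the own child is split once more
  -- into its halves.
  have e (t : ℝ) : rademacher j x * rademacher j t * dyadicKernel j x t * windowSign p L x t
      = (1 / 4 * (dyadicKernel (j + 2) x t * windowSign p L x t)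
        + 1 / 4 * (siblingKernel (j + 1) x t * windowSign p L x t))
        - 1 / 2 * (siblingKernel j x t * windowSign p L x t) := by
    rw [dyadicKernel_succ, siblingKernel, siblingKernel, dyadicKernel_succ]
    ring
  have i1 := (hD (j + 2)).const_mul (1 / 4)
  have i2 := (hS (j + 1)).const_mul (1 / 4)
  have i3 := (hS j).const_mul (1 / 2)
  simp only [e]
  rw [integral_sub (i1.fun_add i2) i3, integral_add i1 i2, integral_const_mul,
    integral_const_mul, integral_const_mul]
  linarith

/-! ### A Walsh polynomial with large partial sums everywhere -/

/-- The factors of the Riesz product: a product of Rademacher functions, and the functions that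
equal `-1` where the digits in a given window follow a given pattern, `1` elsewhere. -/
def windowFactor (p L : ℕ) (J : Finset ℕ) : Option (Fin p × (Fin L → Bool)) → ℝ → ℝ
  | none, t => radProd J t
  | some (u, σ), t => 1 - 2 * ∏ l : Fin L, ((1 + (if σ l then 1 else -1) * rademacher (u + l) t) / 2)

theorem measurable_windowFactor {p L : ℕ} (J : Finset ℕ) (c : Option (Fin p × (Fin L → Bool))) :
    Measurable (windowFactor p L J c) := by
  match c with
  | none => exact measurable_radProd J
  | some (u, σ) =>
    unfold windowFactor
    fun_prop

theorem windowFactor_eq_or {p L : ℕ} (J : Finset ℕ) (c : Option (Fin p × (Fin L → Bool))) (t : ℝ) :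
    windowFactor p L J c t = 1 ∨ windowFactor p L J c t = -1 := by
  match c with
  | none => exact mul_self_eq_one_iff.mp (radProd_mul_self J t)
  | some (u, σ) =>
    have h : ∏ l : Fin L, ((1 + (if σ l then 1 else -1) * rademacher (u + l) t) / 2) = 0 ∨
        ∏ l : Fin L, ((1 + (if σ l then 1 else -1) * rademacher (u + l) t) / 2) = 1 := by
      refine Finset.prod_induction _ (fun a : ℝ => a = 0 ∨ a = 1) ?_ (Or.inr rfl) fun l _ => ?_
      · rintro a b (rfl | rfl) hb
        · simp
        · simpa using hb
      · rcases rademacher_eq_or (u + l) t with h | h <;> split_ifs <;> norm_num [h]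
    simp only [windowFactor]
    rcases h with h | h <;> rw [h] <;> norm_num

theorem windowFactor_congr {p L : ℕ} {J : Finset ℕ} (hJ : ∀ j ∈ J, j < p + L)
    (c : Option (Fin p × (Fin L → Bool))) {x y : ℝ} (h : AgreeTo (p + L) x y) :
    windowFactor p L J c x = windowFactor p L J c y := by
  match c with
  | none => exact Finset.prod_congr rfl fun j hj => h j (hJ j hj)
  | some (u, σ) =>
    simp only [windowFactor]
    rw [Finset.prod_congr rfl fun l _ => by rw [h (u + l) (by omega)]]

/-- The factors that follow the digits of `x`. -/
def followSet (p L : ℕ) (x : ℝ) : Finset (Option (Fin p × (Fin L → Bool))) :=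
  Finset.insertNone (Finset.univ.map
    ⟨fun u : Fin p => (u, fun l => decide (rademacher (u + l) x = 1)),
      fun _ _ h => (Prod.ext_iff.mp h).1⟩)

theorem prod_followSet (p L : ℕ) (J : Finset ℕ) (x t : ℝ) :
    ∏ c ∈ followSet p L x, windowFactor p L J c t = radProd J t * windowSign p L x t := by
  rw [followSet, Finset.prod_insertNone, Finset.prod_map, windowSign, Finset.prod_range]
  congr 1
  refine Finset.prod_congr rfl fun u _ => ?_
  rw [windowMatch, Finset.prod_range]
  simp only [windowFactor]
  congr 2
  refine Finset.prod_congr rfl fun l _ => ?_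
  change (1 + (if decide (rademacher (u + l) x = 1) then 1 else -1) * rademacher (u + l) t) / 2 = _
  rcases rademacher_eq_or (u + l) x with h | h <;> norm_num [h]

/-- Including a factor for every pattern in every window lets one polynomial serve all `x`: the
point only decides which frequency block to look at. Each of the `2 ^ r` digits in `J` contributes
at least `1/4` there. -/
theorem exists_walsh_polynomial (r : ℕ) :
    ∃ (s : ℕ) (a : ℕ → ℝ), a 0 = 1 ∧
      (∀ x, ∑ k ∈ Finset.range (2 ^ s), walsh k x * a k = 0 ∨
        ∑ k ∈ Finset.range (2 ^ s), walsh k x * a k = 2 ^ (32 * (2 ^ r) ^ 2 + 1)) ∧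
      ∀ x, ∃ m n, 2 ≤ m ∧ m ≤ n ∧ n ≤ 2 ^ s ∧
        (2 ^ r : ℝ) / 4 ≤ |∑ k ∈ Finset.Ico m n, walsh k x * a k| := by
  -- Window length `r + 4` makes the error `2 p 2 ^ (-L)` exactly `1/4`. The number of factors is `p
  -- * 2 ^ L + 1 = 32 (2 ^ r) ^ 2 + 1`.
  set p := 2 ^ (r + 1) with hp
  set L := r + 4 with hL
  set Q := p + L with hQdef
  let ι := Option (Fin p × (Fin L → Bool))
  let e : ι ↪ ℕ := (Fintype.equivFin ι).toEmbedding.trans Fin.valEmbedding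
  have he (c : ι) : e c < Fintype.card ι := ((Fintype.equivFin ι) c).isLt
  have hcard : Fintype.card ι = 32 * (2 ^ r) ^ 2 + 1 := by
    simp only [ι, Fintype.card_option, Fintype.card_prod, Fintype.card_fin, Fintype.card_fun,
      Fintype.card_bool, hp, hL]
    ring
  set J : Finset ℕ := (Finset.range (2 ^ r)).image fun i => L + 2 * i with hJdef
  have hJ : ∀ j ∈ J, j < Q := by
    intro j hj
    obtain ⟨i, hi, rfl⟩ := Finset.mem_image.mp hj
    have := Finset.mem_range.mp hi
    rw [hQdef, hp, pow_succ]
    omega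
  set β := windowFactor p L J
  set P := rieszProd Q e β
  have hm (c : ι) : Measurable (β c) := measurable_windowFactor J c
  have hβ (c : ι) (x : ℝ) : β c x = 1 ∨ β c x = -1 := windowFactor_eq_or J c x
  have hQ (c : ι) (x y : ℝ) (h : AgreeTo Q x y) : β c x = β c y := windowFactor_congr hJ c h
  have hP (x : ℝ) : P x = 0 ∨ P x = 2 ^ Fintype.card ι := rieszProd_eq_or e hβ x
  have hPm : Measurable P := by
    unfold P rieszProd
    fun_prop
  have hPi : IntegrableOn P (Ico (0 : ℝ) 1) :=
    integrableOn_of_bounded hPm (C := 2 ^ Fintype.card ι) fun x => by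
      rcases hP x with h | h <;> rw [h] <;> simp
  have hPs (x y : ℝ) (h : AgreeTo (Q + Fintype.card ι) x y) : P x = P y := by
    refine Finset.prod_congr rfl fun c _ => ?_
    rw [hQ c x y (h.mono (Nat.le_add_right _ _)), h (Q + e c) (Nat.add_lt_add_left (he c) Q)]
  have hsum (x : ℝ) :
      ∑ k ∈ Finset.range (2 ^ (Q + Fintype.card ι)), walsh k x * walshCoeff P k = P x :=
    partialSum_two_pow_eq hPi hPs x
  refine ⟨Q + Fintype.card ι, walshCoeff P, ?_, fun x => ?_, fun x => ?_⟩
  · have := walshCoeff_rieszProd e hm hβ hQ ∅ (i := 0) (by positivity)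
    simpa [ofBits, walshCoeff, walsh_zero, P] using this
  · rw [hsum, ← hcard]
    exact hP x
  · set h := ofBits ((followSet p L x).map e)
    -- The factor `none` is always selected, so `h > 0`; with `Q ≥ 1` this gives the bound `2 ≤ m`
    -- needed after dilation.
    have hne : ((followSet p L x).map e).Nonempty := by
      rw [Finset.map_nonempty]
      exact ⟨none, Finset.none_mem_insertNone⟩
    have h1 : 0 < h := Finset.sum_pos (f := fun j => 2 ^ j) (fun _ _ => by positivity) hne
    have h2 : h < 2 ^ Fintype.card ι := ofBits_lt fun j hj => by
      obtain ⟨c, _, rfl⟩ := Finset.mem_map.mp hj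
      exact he c
    have h3 : 2 ≤ 2 ^ Q := by
      calc 2 = 2 ^ 1 := rfl
        _ ≤ 2 ^ Q := Nat.pow_le_pow_right (by norm_num)
          ((by omega : 1 ≤ L).trans (Nat.le_add_left _ _))
    refine ⟨2 ^ Q * h, 2 ^ Q * h + ofBits J, by nlinarith, Nat.le_add_right _ _, ?_, ?_⟩
    · calc _ ≤ 2 ^ Q * (h + 1) := by
            rw [mul_add_one]
            exact Nat.add_le_add_left (ofBits_lt hJ).le _
        _ ≤ 2 ^ Q * 2 ^ Fintype.card ι := Nat.mul_le_mul_left _ h2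
        _ = _ := (pow_add _ _ _).symm
    · have hG : IntegrableOn (windowSign p L x) (Ico (0 : ℝ) 1) :=
        integrableOn_of_bounded (by fun_prop) fun t => (abs_windowSign p L x t).le
      rw [abs_sum_walshCoeff_rieszProd e hm hβ hQ (followSet p L x) hJ
        (prod_followSet p L J x) hG]
      refine le_trans ?_ (le_abs_self _)
      rw [hJdef, Finset.sum_image fun i _ j _ hij => by omega]
      calc (2 ^ r : ℝ) / 4 = ∑ i ∈ Finset.range (2 ^ r), (1 / 4 : ℝ) := by
            rw [Finset.sum_const, Finset.card_range, nsmul_eq_mul]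
            push_cast
            ring
        _ ≤ _ := by
            refine Finset.sum_le_sum fun i hi => ?_
            have hi := Finset.mem_range.mp hi
            refine integral_windowSign_ge (i := 2 * i + 1) ?_ ⟨i, rfl⟩ (by omega) ?_ x
            · rw [hp, pow_succ]
              omega
            · rw [hp, hL]
              push_cast
              rw [pow_add, pow_add]
              field_simp
              norm_num

/-! ### Choice of the scales -/

/-- Take `N` with `N / lam N` above `2 ^ (b + s + 1)` and let `2 ^ (a + s)` be the largest power of
two not exceeding `N`. Monotonicity carries the bound on `lam N` to all smaller indices. -/
theorem exists_scale {lam : ℕ → ℕ} (hmono : MonotoneOn lam (Ici 1))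
    (hlam : ∀ n, 1 ≤ n → 1 ≤ lam n)
    (hsup : ¬ BddAbove ((fun n : ℕ => (n : ℝ) / (lam n : ℝ)) '' Ici 1)) (b s : ℕ) :
    ∃ a ≥ b, ∀ n, 1 ≤ n → n ≤ 2 ^ (a + s) → lam n < 2 ^ a := by
  rw [not_bddAbove_iff] at hsup
  obtain ⟨_, ⟨N, hN, rfl⟩, hlt⟩ := hsup (2 ^ (b + s + 1))
  have hN : 1 ≤ N := hN
  have hlN : 0 < lam N := hlam N hN
  have hlt : 2 ^ (b + s + 1) * lam N < N := by
    dsimp only at hlt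
    rw [lt_div_iff₀ (by exact_mod_cast hlN)] at hlt
    exact_mod_cast hlt
  have h1 : N < 2 ^ (Nat.log 2 N + 1) := Nat.lt_pow_succ_log_self (by norm_num) N
  have h2 : 2 ^ Nat.log 2 N ≤ N := Nat.pow_log_le_self 2 (by omega)
  have h3 : b + s + 1 < Nat.log 2 N + 1 := by
    refine (Nat.pow_lt_pow_iff_right (a := 2) (by norm_num)).mp (lt_trans ?_ h1)
    exact lt_of_le_of_lt (Nat.le_mul_of_pos_right _ hlN) hlt
  refine ⟨Nat.log 2 N - s, by omega, fun n hn hn' => ?_⟩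
  rw [Nat.sub_add_cancel (by omega)] at hn'
  refine (hmono (show n ∈ Ici 1 from hn) (show N ∈ Ici 1 from hN) (hn'.trans h2)).trans_lt ?_
  have h4 : 2 ^ (s + 1) * lam N < 2 ^ (s + 1) * 2 ^ (Nat.log 2 N - s) := by
    rw [← pow_add]
    have : s + 1 + (Nat.log 2 N - s) = Nat.log 2 N + 1 := by omega
    rw [this]
    refine lt_of_le_of_lt ?_ (hlt.trans h1)
    gcongr
    · norm_num
    · omega
  exact lt_of_mul_lt_mul_left h4 (Nat.zero_le _)

theorem exists_scales {lam : ℕ → ℕ} (hmono : MonotoneOn lam (Ici 1))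
    (hlam : ∀ n, 1 ≤ n → 1 ≤ lam n)
    (hsup : ¬ BddAbove ((fun n : ℕ => (n : ℝ) / (lam n : ℝ)) '' Ici 1)) (s : ℕ → ℕ) :
    ∃ b : ℕ → ℕ, (∀ k, b k + s k ≤ b (k + 1)) ∧ (∀ k, k ≤ b k) ∧
      ∀ k n, 1 ≤ n → n ≤ 2 ^ (b k + s k) → lam n < 2 ^ b k := by
  choose F hF hF' using exists_scale hmono hlam hsup
  let b : ℕ → ℕ := fun k => Nat.rec (F 0 (s 0)) (fun k bk => F (bk + s k + 1) (s (k + 1))) k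
  have hb (k : ℕ) : b (k + 1) = F (b k + s k + 1) (s (k + 1)) := rfl
  have hstep (k : ℕ) : b k + s k + 1 ≤ b (k + 1) := hF _ _
  refine ⟨b, fun k => (Nat.le_succ _).trans (hstep k), fun k => ?_, fun k => ?_⟩
  · induction k with
    | zero => exact Nat.zero_le _
    | succ k ih => have := hstep k; omega
  · cases k with
    | zero => exact hF' _ _
    | succ k => exact hF' _ _

/-! ### Orlicz functions -/

namespace IsOrlicz

theorem map_mul_le {ω : ℝ → ℝ} (hω : IsOrlicz ω) {c u : ℝ} (hc : 0 ≤ c) (hc1 : c ≤ 1)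
    (hu : 0 ≤ u) : ω (c * u) ≤ c * ω u := by
  have := hω.convexOn.2 (x := u) hu (y := 0) self_mem_Ici hc (sub_nonneg.mpr hc1)
    (add_sub_cancel c 1)
  simpa [hω.map_zero] using this

theorem map_add_le {ω : ℝ → ℝ} (hω : IsOrlicz ω) {u v : ℝ} (hu : 0 ≤ u) (hv : 0 ≤ v) :
    ω (u + v) ≤ 2⁻¹ * ω (2 * u) + 2⁻¹ * ω (2 * v) := by
  have := hω.convexOn.2 (show 2 * u ∈ Ici 0 from mul_nonneg zero_le_two hu)
    (show 2 * v ∈ Ici 0 from mul_nonneg zero_le_two hv) (show (0 : ℝ) ≤ 2⁻¹ by norm_num)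
    (show (0 : ℝ) ≤ 2⁻¹ by norm_num) (by norm_num)
  simpa using this

/-- Peeling off the first term by midpoint convexity and doubling the rest produces the weights `2 ^
(-k-1)`. No doubling condition on `ω` is needed, since the series is built with the same weights. -/
theorem map_sum_le {ω : ℝ → ℝ} (hω : IsOrlicz ω) (n : ℕ) {y : ℕ → ℝ} (hy : ∀ k, 0 ≤ y k) :
    ω (∑ k ∈ Finset.range n, y k)
      ≤ ∑ k ∈ Finset.range n, (2 ^ (k + 1))⁻¹ * ω (2 ^ (k + 1) * y k) := by
  induction n generalizing y with
  | zero => simp [hω.map_zero]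
  | succ n ih =>
    rw [Finset.sum_range_succ', add_comm, Finset.sum_range_succ' _ n, add_comm (∑ k ∈ _, _)]
    refine (hω.map_add_le (hy 0) (Finset.sum_nonneg fun k _ => hy _)).trans ?_
    have h := ih (y := fun k => 2 * y (k + 1)) fun k => by have := hy (k + 1); positivity
    rw [← Finset.mul_sum] at h
    have h' := mul_le_mul_of_nonneg_left h (by norm_num : (0 : ℝ) ≤ 2⁻¹)
    refine add_le_add (by simp) (h'.trans_eq ?_)
    rw [Finset.mul_sum]
    refine Finset.sum_congr rfl fun k _ => ?_
    rw [← mul_assoc, ← mul_assoc, ← pow_succ, ← mul_inv, ← pow_succ']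

end IsOrlicz

/-! ### Dilated Walsh polynomials -/

/-- The Walsh polynomial with coefficients `a j`, `j < 2 ^ s`. -/
def walshPoly (s : ℕ) (a : ℕ → ℝ) (x : ℝ) : ℝ := ∑ j ∈ Finset.range (2 ^ s), walsh j x * a j

/-- The coefficients of the dilation by `2 ^ b` of a Walsh polynomial. -/
def dilate (b : ℕ) (a : ℕ → ℝ) (n : ℕ) : ℝ := if 2 ^ b ∣ n then a (n / 2 ^ b) else 0

theorem sum_Ico_dilate (b : ℕ) (a : ℕ → ℝ) (m n : ℕ) (x : ℝ) :
    ∑ i ∈ Finset.Ico (2 ^ b * m) (2 ^ b * n), walsh i x * dilate b a i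
      = ∑ j ∈ Finset.Ico m n, walsh j (2 ^ b * x) * a j := by
  have hb : 0 < 2 ^ b := by positivity
  refine Eq.symm (Finset.sum_of_injOn (fun j => 2 ^ b * j) ?_ ?_ ?_ ?_)
  · intro i _ j _ h
    exact Nat.eq_of_mul_eq_mul_left hb h
  · intro j hj
    simp only [Finset.coe_Ico, mem_Ico] at hj ⊢
    exact ⟨Nat.mul_le_mul_left _ hj.1, Nat.mul_lt_mul_of_pos_left hj.2 hb⟩
  · intro i hi hi'
    rw [dilate, if_neg, mul_zero]
    rintro ⟨j, rfl⟩
    refine hi' ⟨j, ?_, rfl⟩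
    simp only [Finset.coe_Ico, Finset.mem_Ico, mem_Ico] at hi ⊢
    exact ⟨Nat.le_of_mul_le_mul_left hi.1 hb, Nat.lt_of_mul_lt_mul_left hi.2⟩
  · intro j _
    rw [dilate, if_pos (dvd_mul_right _ _), Nat.mul_div_cancel_left _ hb, walsh_two_pow_mul]

theorem walshPoly_two_pow_mul (s b : ℕ) (a : ℕ → ℝ) (x : ℝ) :
    walshPoly s a (2 ^ b * x) = walshPoly (b + s) (dilate b a) x := by
  have := sum_Ico_dilate b a 0 (2 ^ s) x
  rw [mul_zero, ← Finset.range_eq_Ico, ← Finset.range_eq_Ico, ← pow_add] at this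
  exact this.symm

theorem walshCoeff_walshPoly (s : ℕ) (a : ℕ → ℝ) (n : ℕ) :
    walshCoeff (walshPoly s a) n = if n < 2 ^ s then a n else 0 := by
  refine (walshCoeff_sum_walsh_smul (𝕜 := ℝ) (Finset.range (2 ^ s)) a n).trans ?_
  simp

theorem integrableOn_walshPoly (s : ℕ) (a : ℕ → ℝ) :
    IntegrableOn (walshPoly s a) (Ico (0 : ℝ) 1) :=
  integrableOn_sum_walsh_smul (𝕜 := ℝ) _ _

theorem integral_walshPoly (s : ℕ) (a : ℕ → ℝ) :
    ∫ x in Ico (0 : ℝ) 1, walshPoly s a x = a 0 := by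
  have := walshCoeff_walshPoly s a 0
  simpa [walshCoeff, walsh_zero] using this

/-- The polynomial takes only the values 0 and `H`, so the Orlicz bound has to be checked only at `γ
* H`. The little-o hypothesis provides room for a factor `8 ^ k`, which will beat the weight `2 ^
(-k-1)`. -/
theorem exists_blocks {ω : ℝ → ℝ} (hω : IsOrlicz ω)
    (ho : ω =o[atTop] fun t : ℝ => t * Real.sqrt (Real.log t)) (k : ℕ) :
    ∃ (s : ℕ) (a : ℕ → ℝ) (γ : ℝ), 0 ≤ γ ∧ γ ≤ 1 ∧ a 0 = 1 ∧ (∀ x, 0 ≤ walshPoly s a x) ∧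
      (∀ x, ω (γ * walshPoly s a x) ≤ 6 * walshPoly s a x) ∧
      ∀ x, ∃ m n, 2 ≤ m ∧ m ≤ n ∧ n ≤ 2 ^ s ∧
        8 ^ k / 4 ≤ γ * |∑ j ∈ Finset.Ico m n, walsh j x * a j| := by
  have hq : Tendsto (fun r : ℕ => 2 ^ r) atTop atTop := tendsto_pow_atTop_atTop_of_one_lt one_lt_two
  have hH : Tendsto (fun r : ℕ => (2 : ℝ) ^ (32 * (2 ^ r) ^ 2 + 1)) atTop atTop := by
    refine (tendsto_pow_atTop_atTop_of_one_lt one_lt_two).comp (tendsto_atTop_mono (fun r => ?_) hq)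
    nlinarith [Nat.zero_le (2 ^ r)]
  have hev := hH.eventually (ho.bound (show (0 : ℝ) < (8 ^ k)⁻¹ by positivity))
  obtain ⟨r, hr, hrk⟩ := (hev.and (hq.eventually_ge_atTop (8 ^ k))).exists
  obtain ⟨s, a, ha, hP, hx⟩ := exists_walsh_polynomial r
  set q : ℝ := 2 ^ r with hqdef
  have hq0 : 0 < q := by positivity
  have hq1 : 1 ≤ q := one_le_pow₀ one_le_two
  have hkq : (8 : ℝ) ^ k ≤ q := by
    rw [hqdef]
    exact_mod_cast hrk
  set H : ℝ := 2 ^ (32 * (2 ^ r) ^ 2 + 1) with hHdef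
  have hH0 : 0 < H := by positivity
  -- Here `log H ≤ 32 q ^ 2 + 1 ≤ 36 q ^ 2`, as `log 2 ≤ 1 ≤ q`.
  have hlog : Real.sqrt (Real.log H) ≤ 6 * q := by
    rw [Real.sqrt_le_left (by positivity), hHdef, Real.log_pow]
    have h1 : Real.log 2 ≤ 1 := by linarith [Real.log_two_lt_d9]
    have h2 : 0 ≤ Real.log 2 := Real.log_nonneg one_le_two
    push_cast
    rw [← hqdef]
    nlinarith [mul_le_mul_of_nonneg_left h1 (show 0 ≤ 32 * q ^ 2 + 1 by positivity)]
  -- With `γ = 8 ^ k / q`, the block of size `q / 4` becomes `8 ^ k / 4`. In `γ * ω H` the factors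
  -- `8 ^ k` and `q` cancel against the little-o constant and `√(log H)`.
  have hγ : 8 ^ k / q ≤ 1 := (div_le_one hq0).mpr hkq
  have hωH : ω (8 ^ k / q * H) ≤ 6 * H := by
    rw [Real.norm_of_nonneg (show 0 ≤ H * Real.sqrt (Real.log H) by positivity),
      Real.norm_eq_abs] at hr
    calc ω (8 ^ k / q * H) ≤ 8 ^ k / q * ω H := hω.map_mul_le (by positivity) hγ hH0.le
      _ ≤ 8 ^ k / q * ((8 ^ k)⁻¹ * (H * (6 * q))) := by
          gcongr
          refine (le_abs_self _).trans (hr.trans ?_)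
          gcongr
      _ = 6 * H := by field_simp
  refine ⟨s, a, 8 ^ k / q, by positivity, hγ, ha, fun x => ?_, fun x => ?_, fun x => ?_⟩
  · rcases hP x with h | h <;> rw [walshPoly, h]
    positivity
  · rcases hP x with h | h <;> rw [walshPoly, h]
    · simp [hω.map_zero]
    · exact hωH
  · obtain ⟨m, n, h1, h2, h3, h4⟩ := hx x
    refine ⟨m, n, h1, h2, h3, ?_⟩
    calc (8 : ℝ) ^ k / 4 = 8 ^ k / q * (q / 4) := by field_simp
      _ ≤ _ := by gcongr

/-! ### The divergent series -/

theorem partialSum_eq_of_walshCoeff_eq_zero {f : ℝ → ℝ} {m n : ℕ} (hmn : m ≤ n)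
    (h : ∀ i, m ≤ i → i < n → walshCoeff f i = 0) (x : ℝ) : partialSum f m x = partialSum f n x := by
  rw [partialSum, partialSum, ← Finset.sum_range_add_sum_Ico _ hmn, left_eq_add]
  refine Finset.sum_eq_zero fun i hi => ?_
  rw [h i (Finset.mem_Ico.mp hi).1 (Finset.mem_Ico.mp hi).2, smul_zero]

theorem vpMean_eq_partialSum {lam : ℕ → ℕ} {f : ℝ → ℝ} {n : ℕ} (hn : lam n ≤ n) {x : ℝ}
    (h : ∀ k, n - lam n ≤ k → k ≤ n → partialSum f k x = partialSum f n x) :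
    vpMean lam f n x = partialSum f n x := by
  rw [vpMean, Finset.sum_congr rfl fun k hk =>
    h k (Finset.mem_Icc.mp hk).1 (Finset.mem_Icc.mp hk).2, Finset.sum_const, Nat.card_Icc,
    show n + 1 - (n - lam n) = lam n + 1 by omega, ← Nat.cast_smul_eq_nsmul ℝ, smul_smul]
  push_cast
  rw [inv_mul_cancel₀ (by positivity), one_smul]

/-- The indices averaged at `2 ^ b * i` all lie above `2 ^ b * (i - 1)`, in one spectral gap, so the
averaged partial sums coincide. Taking a difference of two means removes all frequencies below the
block. -/
theorem vpMean_sub_vpMean_of_block {lam : ℕ → ℕ} (hlam : ∀ n, 1 ≤ n → lam n ≤ n) {f : ℝ → ℝ}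
    {b s : ℕ} (hb : ∀ n, 1 ≤ n → n ≤ 2 ^ (b + s) → lam n < 2 ^ b) {c : ℝ} {a : ℕ → ℝ}
    (hf : ∀ n, 2 ^ b ≤ n → n < 2 ^ (b + s) → walshCoeff f n = c * dilate b a n) {m n : ℕ}
    (hm : 2 ≤ m) (hmn : m ≤ n) (hn : n ≤ 2 ^ s) (x : ℝ) :
    vpMean lam f (2 ^ b * n) x - vpMean lam f (2 ^ b * m) x
      = c * ∑ j ∈ Finset.Ico m n, walsh j (2 ^ b * x) * a j := by
  have hpos : 0 < 2 ^ b := by positivity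
  have hle {i : ℕ} (hi : i ≤ 2 ^ s) : 2 ^ b * i ≤ 2 ^ (b + s) := by
    rw [pow_add]
    exact Nat.mul_le_mul_left _ hi
  have hV {i : ℕ} (hi : 2 ≤ i) (hi' : i ≤ 2 ^ s) :
      vpMean lam f (2 ^ b * i) x = partialSum f (2 ^ b * i) x := by
    have h1 : 1 ≤ 2 ^ b * i := Nat.mul_pos hpos (by omega)
    have h2 := hb _ h1 (hle hi')
    refine vpMean_eq_partialSum (hlam _ h1) fun k hk hk' =>
      partialSum_eq_of_walshCoeff_eq_zero hk' (fun l hl hl' => ?_) x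
    -- Because `i ≥ 2`, the gap lies above `2 ^ b`, where the coefficients of `f` are those of the
    -- block alone.
    obtain ⟨i, rfl⟩ : ∃ t, i = t + 2 := ⟨i - 2, by omega⟩
    have h4 : 2 ^ b * (i + 2) = 2 ^ b * (i + 1) + 2 ^ b := by ring
    have h3 : 2 ^ b * (i + 1) < l := by omega
    rw [hf l ?_ (hl'.trans_le (hle hi')), dilate, if_neg, mul_zero]
    · rintro ⟨j, rfl⟩
      have := Nat.lt_of_mul_lt_mul_left h3
      have := Nat.lt_of_mul_lt_mul_left hl'
      omega
    · nlinarith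
  rw [hV (hm.trans hmn) hn, hV hm (hmn.trans hn), partialSum, partialSum,
    ← Finset.sum_Ico_eq_sub _ (Nat.mul_le_mul_left _ hmn), ← sum_Ico_dilate, Finset.mul_sum]
  refine Finset.sum_congr rfl fun i hi => ?_
  obtain ⟨h1, h2⟩ := Finset.mem_Ico.mp hi
  rw [hf i (by nlinarith) (h2.trans_le (hle hn)), smul_eq_mul]
  ring

section Series

variable {s b : ℕ → ℕ} {a : ℕ → ℕ → ℝ} {γ : ℕ → ℝ}

/-- A weighted dilation of a Walsh polynomial. -/
def blockTerm (s b : ℕ → ℕ) (a : ℕ → ℕ → ℝ) (γ : ℕ → ℝ) (k : ℕ) (x : ℝ) : ℝ :=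
  (2 ^ (k + 1))⁻¹ * (γ k * walshPoly (s k) (a k) (2 ^ b k * x))

/-- The sum of the dilated Walsh polynomials `2^(-k-1) γ_k P_k(2^(b_k) x)`. -/
def blockSeries (s b : ℕ → ℕ) (a : ℕ → ℕ → ℝ) (γ : ℕ → ℝ) (x : ℝ) : ℝ :=
  ∑' k, blockTerm s b a γ k x

theorem walshCoeff_const_mul (c : ℝ) (f : ℝ → ℝ) (n : ℕ) :
    walshCoeff (fun x => c * f x) n = c * walshCoeff f n := by
  simp only [walshCoeff, smul_eq_mul, mul_left_comm _ c]
  exact integral_const_mul _ _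

theorem integral_dilated (ha : ∀ k, a k 0 = 1) (k : ℕ) :
    ∫ x in Ico (0 : ℝ) 1, walshPoly (s k) (a k) (2 ^ b k * x) = 1 := by
  simp only [walshPoly_two_pow_mul]
  rw [integral_walshPoly, dilate, if_pos (dvd_zero _), Nat.zero_div, ha]

theorem integrableOn_dilated (s b : ℕ → ℕ) (a : ℕ → ℕ → ℝ) (k : ℕ) :
    IntegrableOn (fun x => walshPoly (s k) (a k) (2 ^ b k * x)) (Ico (0 : ℝ) 1) := by
  simp only [walshPoly_two_pow_mul]
  exact integrableOn_walshPoly _ _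

theorem summable_half : Summable fun k : ℕ => ((2 : ℝ) ^ (k + 1))⁻¹ := by
  have := (summable_nat_add_iff 1).mpr summable_geometric_two
  simpa only [one_div, inv_pow] using this

theorem hasSum_walshCoeff_tsum {F : ℕ → ℝ → ℝ} (hF0 : ∀ k x, 0 ≤ F k x)
    (hFi : ∀ k, IntegrableOn (F k) (Ico (0 : ℝ) 1))
    (hF : Summable fun k => ∫ x in Ico (0 : ℝ) 1, F k x) (n : ℕ) :
    HasSum (fun k => walshCoeff (F k) n) (walshCoeff (fun x => ∑' k, F k x) n) := by
  have h := hasSum_integral_of_summable_integral_norm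
    (F := fun k x => walsh n x • F k x) (μ := volume.restrict (Ico (0 : ℝ) 1))
    (fun k => integrableOn_walsh_smul n (hFi k)) (by
      simpa only [norm_smul, Real.norm_eq_abs, abs_walsh, one_mul, abs_of_nonneg (hF0 _ _)] using hF)
  simpa only [walshCoeff, smul_eq_mul, tsum_mul_left] using h

theorem lintegral_tsum_ofReal_lt_top {F : ℕ → ℝ → ℝ} (hF0 : ∀ k x, 0 ≤ F k x)
    (hFi : ∀ k, IntegrableOn (F k) (Ico (0 : ℝ) 1))
    (hF : Summable fun k => ∫ x in Ico (0 : ℝ) 1, F k x) :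
    ∫⁻ x in Ico (0 : ℝ) 1, ∑' k, ENNReal.ofReal (F k x) < ⊤ := by
  rw [lintegral_tsum fun k => (hFi k).1.aemeasurable.ennreal_ofReal]
  simp only [← ofReal_integral_eq_lintegral_ofReal (hFi _) (Eventually.of_forall (hF0 _))]
  exact hF.tsum_ofReal_lt_top

theorem ae_summable_of_summable_integral {F : ℕ → ℝ → ℝ} (hF0 : ∀ k x, 0 ≤ F k x)
    (hFi : ∀ k, IntegrableOn (F k) (Ico (0 : ℝ) 1))
    (hF : Summable fun k => ∫ x in Ico (0 : ℝ) 1, F k x) :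
    ∀ᵐ x ∂(volume.restrict (Ico (0 : ℝ) 1)), Summable fun k => F k x := by
  have hm : AEMeasurable (fun x => ∑' k, ENNReal.ofReal (F k x))
      (volume.restrict (Ico (0 : ℝ) 1)) :=
    AEMeasurable.tsum fun k => (hFi k).1.aemeasurable.ennreal_ofReal
  filter_upwards [ae_lt_top' hm (lintegral_tsum_ofReal_lt_top hF0 hFi hF).ne] with x hx
  have := ENNReal.summable_toReal hx.ne
  simpa only [ENNReal.toReal_ofReal (hF0 _ _)] using this

theorem integrableOn_tsum {F : ℕ → ℝ → ℝ} (hF0 : ∀ k x, 0 ≤ F k x)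
    (hFi : ∀ k, IntegrableOn (F k) (Ico (0 : ℝ) 1))
    (hF : Summable fun k => ∫ x in Ico (0 : ℝ) 1, F k x) :
    IntegrableOn (fun x => ∑' k, F k x) (Ico (0 : ℝ) 1) := by
  have hs := ae_summable_of_summable_integral hF0 hFi hF
  refine ⟨?_, ?_⟩
  · refine aestronglyMeasurable_of_tendsto_ae atTop
      (f := fun n x => ∑ k ∈ Finset.range n, F k x)
      (fun n => Finset.aestronglyMeasurable_fun_sum _ fun k _ => (hFi k).1) ?_
    filter_upwards [hs] with x hx
    exact hx.hasSum.tendsto_sum_nat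
  · refine lt_of_le_of_lt (lintegral_mono_ae ?_) (lintegral_tsum_ofReal_lt_top hF0 hFi hF)
    filter_upwards [hs] with x hx
    rw [Real.enorm_of_nonneg (tsum_nonneg fun k => hF0 k x),
      ENNReal.ofReal_tsum_of_nonneg (fun k => hF0 k x) hx]

theorem walshCoeff_dilated (b s : ℕ) (a : ℕ → ℝ) (n : ℕ) :
    walshCoeff (fun x => walshPoly s a (2 ^ b * x)) n
      = if n < 2 ^ (b + s) then dilate b a n else 0 := by
  simp only [walshPoly_two_pow_mul]
  exact walshCoeff_walshPoly _ _ n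

theorem blockTerm_nonneg (hγ0 : ∀ k, 0 ≤ γ k) (hP : ∀ k x, 0 ≤ walshPoly (s k) (a k) x) (k : ℕ)
    (x : ℝ) : 0 ≤ blockTerm s b a γ k x :=
  mul_nonneg (by positivity) (mul_nonneg (hγ0 k) (hP k _))

theorem integrableOn_blockTerm (k : ℕ) : IntegrableOn (blockTerm s b a γ k) (Ico (0 : ℝ) 1) :=
  ((integrableOn_dilated s b a k).const_mul _).const_mul _

theorem summable_integral_blockTerm (ha : ∀ k, a k 0 = 1) (hγ0 : ∀ k, 0 ≤ γ k)
    (hγ1 : ∀ k, γ k ≤ 1) : Summable fun k => ∫ x in Ico (0 : ℝ) 1, blockTerm s b a γ k x := by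
  have h (k : ℕ) : ∫ x in Ico (0 : ℝ) 1, blockTerm s b a γ k x = (2 ^ (k + 1))⁻¹ * γ k := by
    unfold blockTerm
    rw [integral_const_mul, integral_const_mul, integral_dilated ha, mul_one]
  simp only [h]
  exact Summable.of_nonneg_of_le (fun k => mul_nonneg (by positivity) (hγ0 k))
    (fun k => mul_le_of_le_one_right (by positivity) (hγ1 k)) summable_half

/-- Earlier blocks have spectrum below `2 ^ b k`. Later ones live on multiples of `2 ^ b j`, and the
first nonzero multiple already exceeds `n`. -/
theorem walshCoeff_blockSeries (ha : ∀ k, a k 0 = 1) (hγ0 : ∀ k, 0 ≤ γ k) (hγ1 : ∀ k, γ k ≤ 1)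
    (hP : ∀ k x, 0 ≤ walshPoly (s k) (a k) x) (hb : ∀ k, b k + s k ≤ b (k + 1)) {k n : ℕ}
    (hn : 2 ^ b k ≤ n) (hn' : n < 2 ^ (b k + s k)) :
    walshCoeff (blockSeries s b a γ) n = (2 ^ (k + 1))⁻¹ * γ k * dilate (b k) (a k) n := by
  have hmono : Monotone b := monotone_nat_of_le_succ fun k => (Nat.le_add_right _ _).trans (hb k)
  have hterm (j : ℕ) : walshCoeff (blockTerm s b a γ j) n
      = if j = k then (2 ^ (k + 1))⁻¹ * γ k * dilate (b k) (a k) n else 0 := by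
    have h1 : walshCoeff (blockTerm s b a γ j) n
        = (2 ^ (j + 1))⁻¹ * (γ j * if n < 2 ^ (b j + s j) then dilate (b j) (a j) n else 0) := by
      unfold blockTerm
      rw [walshCoeff_const_mul, walshCoeff_const_mul, walshCoeff_dilated]
    rw [h1]
    rcases lt_trichotomy j k with h | rfl | h
    · have : b j + s j ≤ b k := (hb j).trans (hmono h)
      have : 2 ^ (b j + s j) ≤ 2 ^ b k := Nat.pow_le_pow_right (by norm_num) this
      rw [if_neg (by omega), if_neg h.ne, mul_zero, mul_zero]
    · rw [if_pos hn', if_pos rfl]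
      ring
    · have : b k + s k ≤ b j := (hb k).trans (hmono h)
      have : 2 ^ (b k + s k) ≤ 2 ^ b j := Nat.pow_le_pow_right (by norm_num) this
      have hpos : 0 < 2 ^ b k := by positivity
      have : ¬ 2 ^ b j ∣ n := fun hd => by
        have := Nat.le_of_dvd (by omega) hd
        omega
      rw [dilate, if_neg this, if_neg h.ne', ite_self, mul_zero, mul_zero]
  have hsum := hasSum_walshCoeff_tsum (blockTerm_nonneg hγ0 hP) integrableOn_blockTerm
    (summable_integral_blockTerm (b := b) ha hγ0 hγ1) n
  simp only [hterm] at hsum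
  exact hsum.unique (hasSum_ite_eq k _)

theorem integrableOn_blockSeries (ha : ∀ k, a k 0 = 1) (hγ0 : ∀ k, 0 ≤ γ k) (hγ1 : ∀ k, γ k ≤ 1)
    (hP : ∀ k x, 0 ≤ walshPoly (s k) (a k) x) :
    IntegrableOn (blockSeries s b a γ) (Ico (0 : ℝ) 1) :=
  integrableOn_tsum (blockTerm_nonneg hγ0 hP) integrableOn_blockTerm
    (summable_integral_blockTerm ha hγ0 hγ1)

theorem lintegral_orlicz_blockSeries_lt_top {ω : ℝ → ℝ} (hω : IsOrlicz ω) (ha : ∀ k, a k 0 = 1)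
    (hγ0 : ∀ k, 0 ≤ γ k) (hγ1 : ∀ k, γ k ≤ 1) (hP : ∀ k x, 0 ≤ walshPoly (s k) (a k) x)
    (hωP : ∀ k x, ω (γ k * walshPoly (s k) (a k) x) ≤ 6 * walshPoly (s k) (a k) x) :
    ∫⁻ x in Ico (0 : ℝ) 1, ENNReal.ofReal (ω (blockSeries s b a γ x)) < ⊤ := by
  -- The same series with every `γ k` replaced by the constant of `hωP` is an integrable majorant of
  -- `ω` of the sum.
  set G : ℕ → ℝ → ℝ := blockTerm s b a fun _ => 6
  have hG0 (k : ℕ) (x : ℝ) : 0 ≤ G k x := blockTerm_nonneg (fun _ => by norm_num) hP k x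
  have hG : Summable fun k => ∫ x in Ico (0 : ℝ) 1, G k x := by
    have h := (summable_integral_blockTerm (s := s) (b := b) (γ := fun _ => 1) ha (by simp)
      (by simp)).mul_left 6
    refine h.congr fun k => ?_
    rw [← integral_const_mul]
    refine integral_congr_ae (Eventually.of_forall fun x => ?_)
    simp only [G, blockTerm]
    ring
  refine lt_of_le_of_lt (lintegral_mono_ae ?_)
    (lintegral_tsum_ofReal_lt_top hG0 integrableOn_blockTerm hG)
  filter_upwards [ae_summable_of_summable_integral (blockTerm_nonneg hγ0 hP) integrableOn_blockTerm
    (summable_integral_blockTerm (b := b) ha hγ0 hγ1)] with x hx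
  have hnn : ∀ k, 0 ≤ blockTerm s b a γ k x := fun k => blockTerm_nonneg hγ0 hP k x
  have hlim : Tendsto (fun n => ω (∑ k ∈ Finset.range n, blockTerm s b a γ k x)) atTop
      (𝓝 (ω (blockSeries s b a γ x))) := by
    refine (hω.continuousOn _ (show _ ∈ Ici 0 from tsum_nonneg hnn)).tendsto.comp ?_
    exact tendsto_nhdsWithin_iff.mpr ⟨hx.hasSum.tendsto_sum_nat,
      Eventually.of_forall fun n => Finset.sum_nonneg fun k _ => hnn k⟩
  refine le_of_tendsto' ((ENNReal.continuous_ofReal.tendsto _).comp hlim) fun n => ?_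
  calc ENNReal.ofReal (ω (∑ k ∈ Finset.range n, blockTerm s b a γ k x))
      ≤ ENNReal.ofReal (∑ k ∈ Finset.range n, G k x) := by
        refine ENNReal.ofReal_le_ofReal ((hω.map_sum_le n hnn).trans
          (Finset.sum_le_sum fun k _ => ?_))
        simp only [G, blockTerm]
        rw [mul_inv_cancel_left₀ (by positivity)]
        gcongr
        exact hωP k _
    _ = ∑ k ∈ Finset.range n, ENNReal.ofReal (G k x) :=
        ENNReal.ofReal_sum_of_nonneg fun k _ => hG0 k x
    _ ≤ _ := ENNReal.sum_le_tsum _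

end Series

/-! ### The everywhere divergent function and the conclusion -/

theorem exists_real_divergent {lam : ℕ → ℕ} (hmono : MonotoneOn lam (Ici 1))
    (hlam : ∀ n, 1 ≤ n → 1 ≤ lam n ∧ lam n ≤ n) {ω : ℝ → ℝ} (hω : IsOrlicz ω)
    (ho : ω =o[atTop] fun t : ℝ => t * Real.sqrt (Real.log t))
    (hsup : ¬ BddAbove ((fun n : ℕ => (n : ℝ) / (lam n : ℝ)) '' Ici 1)) :
    ∃ f : ℝ → ℝ, (∀ x, 0 ≤ f x) ∧ IntegrableOn f (Ico (0 : ℝ) 1) ∧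
      ∫⁻ x in Ico (0 : ℝ) 1, ENNReal.ofReal (ω (f x)) < ⊤ ∧
      ∀ x (M : ℝ) (N : ℕ), ∃ n ≥ N, M ≤ |vpMean lam f n x| := by
  choose s a γ hγ0 hγ1 ha hP hωP hx using exists_blocks hω ho
  obtain ⟨b, hbs, hkb, hlb⟩ := exists_scales hmono (fun n hn => (hlam n hn).1) hsup s
  refine ⟨blockSeries s b a γ, fun x => tsum_nonneg fun k => blockTerm_nonneg hγ0 hP k x,
    integrableOn_blockSeries ha hγ0 hγ1 hP,
    lintegral_orlicz_blockSeries_lt_top hω ha hγ0 hγ1 hP hωP, fun x M N => ?_⟩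
  -- The two means will differ by at least `2 ^ (-k-1) * 8 ^ k / 4 = 4 ^ k / 8`. Hence `4 ^ k ≥ 16
  -- M` forces one of them to have modulus at least `M`, and `k ≥ N` makes both indices at least
  -- `N`.
  obtain ⟨k, hkM, hkN⟩ := (((tendsto_pow_atTop_atTop_of_one_lt
    (by norm_num : (1 : ℝ) < 4)).eventually_ge_atTop (16 * M)).and (eventually_ge_atTop N)).exists
  obtain ⟨m, n, hm, hmn, hn, hbig⟩ := hx k (2 ^ b k * x)
  have hdiff := vpMean_sub_vpMean_of_block (fun n hn => (hlam n hn).2) (hlb k)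
    (fun n h h' => walshCoeff_blockSeries ha hγ0 hγ1 hP hbs h h') hm hmn hn x
  have hge : 2 * M ≤ |vpMean lam (blockSeries s b a γ) (2 ^ b k * n) x
      - vpMean lam (blockSeries s b a γ) (2 ^ b k * m) x| := by
    rw [hdiff, abs_mul, abs_of_nonneg (mul_nonneg (by positivity) (hγ0 k)), mul_assoc]
    calc 2 * M ≤ 4 ^ k / 8 := by linarith
      _ = (2 ^ (k + 1))⁻¹ * (8 ^ k / 4) := by
          have : (8 : ℝ) ^ k = 4 ^ k * 2 ^ k := by rw [← mul_pow]; norm_num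
          rw [this, pow_succ]
          field_simp
          norm_num
      _ ≤ _ := by gcongr
  have hN {i : ℕ} (hi : 1 ≤ i) : N ≤ 2 ^ b k * i :=
    (hkN.trans ((hkb k).trans Nat.lt_two_pow_self.le)).trans (Nat.le_mul_of_pos_right _ hi)
  by_contra! hcon
  have h1 := hcon _ (hN (by omega : 1 ≤ n))
  have h2 := hcon _ (hN (by omega : 1 ≤ m))
  have h3 := abs_sub (vpMean lam (blockSeries s b a γ) (2 ^ b k * n) x)
    (vpMean lam (blockSeries s b a γ) (2 ^ b k * m) x)
  linarith

theorem vpMean_ofReal {𝕜 : Type*} [RCLike 𝕜] (lam : ℕ → ℕ) (f : ℝ → ℝ) (n : ℕ) (x : ℝ) :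
    vpMean lam (fun x => (f x : 𝕜)) n x = ((vpMean lam f n x : ℝ) : 𝕜) := by
  have h (k : ℕ) : walshCoeff (fun x => (f x : 𝕜)) k = ((walshCoeff f k : ℝ) : 𝕜) := by
    simp only [walshCoeff, smul_eq_mul, RCLike.real_smul_eq_coe_mul]
    rw [← integral_ofReal]
    simp
  simp only [vpMean, partialSum, h, smul_eq_mul, RCLike.real_smul_eq_coe_mul]
  push_cast
  rfl

end WalshVP

end

theorem theorem1p1 {𝕜 : Type*} [RCLike 𝕜] (lam : ℕ → ℕ)
    (hmono : MonotoneOn lam (Set.Ici 1))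
    (hlam : ∀ n : ℕ, 1 ≤ n → 1 ≤ lam n ∧ lam n ≤ n) :
    ((fun n : ℕ => (n : ℝ)) =O[atTop] (fun n : ℕ => (lam n : ℝ)) →
      ∀ f : ℝ → 𝕜, IntegrableOn f (Set.Ico (0 : ℝ) 1) →
        ∀ᵐ x ∂(volume.restrict (Set.Ico (0 : ℝ) 1)),
          Tendsto (fun n : ℕ => WalshVP.vpMean lam f n x) atTop (𝓝 (f x))) ∧
    (∀ ω : ℝ → ℝ, WalshVP.IsOrlicz ω →
      ω =o[atTop] (fun t : ℝ => t * Real.sqrt (Real.log t)) →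
      ¬ BddAbove ((fun n : ℕ => (n : ℝ) / (lam n : ℝ)) '' Set.Ici 1) →
      ∃ f : ℝ → 𝕜, WalshVP.MemOrliczClass ω f ∧ IntegrableOn f (Set.Ico (0 : ℝ) 1) ∧
        ∀ x ∈ Set.Ico (0 : ℝ) 1,
          limsup (fun n : ℕ => ‖WalshVP.vpMean lam f n x‖ₑ) atTop = ⊤) := by
  refine ⟨fun hO f hf => WalshVP.ae_tendsto_vpMean (fun n hn => (hlam n hn).2) hO hf,
    fun ω hω ho hsup => ?_⟩
  obtain ⟨f, hf0, hfi, hfω, hdiv⟩ := WalshVP.exists_real_divergent hmono hlam hω ho hsup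
  have hfi' : IntegrableOn (fun x => (f x : 𝕜)) (Set.Ico (0 : ℝ) 1) := Integrable.ofReal hfi
  refine ⟨fun x => (f x : 𝕜), ⟨hfi'.1, ?_⟩, hfi', fun x _ => ?_⟩
  · simpa only [RCLike.norm_ofReal, abs_of_nonneg (hf0 _)] using hfω
  · refine ENNReal.eq_top_of_forall_nnreal_le fun M => le_limsup_of_frequently_le ?_
    refine frequently_atTop.mpr fun N => ?_
    obtain ⟨n, hn, hM⟩ := hdiv x M N
    refine ⟨n, hn, ?_⟩
    rw [WalshVP.vpMean_ofReal, ← ofReal_norm, RCLike.norm_ofReal, ← ENNReal.ofReal_coe_nnreal]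
    exact ENNReal.ofReal_le_ofReal hM
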